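/- Let $1<p<\infty$, let $\ell_p$ be the complex sequence space, let $\{e_n\}_{n\ge1}$ be a symmetric basis of $\ell_p$ (a Schauder basis such that, for every permutation $\sigma$ of $\mathbb N$, $\{e_{\sigma(n)}\}$ is a Schauder basis equivalent to $\{e_n\}$), let $T$ be the bounded operator on $\ell_p$ with $Te_n=e_{n+1}$, and let $k\ge1$ be an integer. For a complex sequence $c$ put $(\Delta c)_n=c_n-c_{n-1}$ with $c_0=0$, and let $\ell_p(\Delta^k)=\{c:\ \Delta^kc\in\ell_p\}$. Let $\ell_{p,k}(\{e_n\})$ be the completion of $\ell_p$ with respect to the norm $\|(I-T)^kx\|$. It is the Banach space of formal series $x=(\mathfrak f)\sum_n c_ne_n$ with $c\in\ell_p(\Delta^k)$ and norm $\|x\|_k=\big\|\sum_n(\Delta^kc)_ne_n\big\|$, the series being convergent in $\ell_p$. Then: 1. $\{e_n\}$ is not a Schauder basis of $\ell_{p,k}(\{e_n\})$. 2. Let $f_k\in\mathcal S_k$, that is, $f_k:[1,\infty)\to\mathbb R$, $\lim_{x\to\infty}f_k(x)=+\infty$, and for every $j=1,\dots,k$ the limit $\lim_{n\to\infty}n^k|f_k(n-j)-f_k(n)|$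 exists and is finite. Then the operator $$A_k\,(\mathfrak f)\sum_nc_ne_n=(\mathfrak f)\sum_n i f_k(n)c_ne_n,\qquad D(A_k)=\Big\{(\mathfrak f)\sum_nc_ne_n\in\ell_{p,k}(\{e_n\}):\ \{f_k(n)c_n\}\in\ell_p(\Delta^k)\Big\},$$ generates a $C_0$-group on $\ell_{p,k}(\{e_n\})$. The same holds, without the condition $f_k(x)\to+\infty$, for every $f_k:[1,\infty)\to\mathbb R$ such that $n^k|f_k(n-j)-f_k(n)|$, $n>j$, is bounded for each $j=1,\dots,k$. -/

import Mathlib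

open Filter Topology
open scoped ENNReal

noncomputable section

namespace DiagonalGroup

/-! Sequences are indexed by `ℕ` starting at `0`: the entry with index `n` of a Lean sequence is the
entry with index `n + 1` of the mathematical sequence indexed by `1, 2, 3, …`. -/

/-- The backward difference `(Δ c)_n = c_n - c_{n-1}`, where the entry before the first one is `0`. -/
def diff : (ℕ → ℂ) →ₗ[ℂ] (ℕ → ℂ) where
  toFun c n := c n - (match n with
    | 0 => 0
    | m + 1 => c m)
  map_add' c d := by
    funext n
    cases n
    · simp
    · simp only [Pi.add_apply]; ring
  map_smul' a c := by
    funext n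
    cases n
    · simp
    · simp only [Pi.smul_apply, smul_eq_mul, RingHom.id_apply]; ring

section General

variable {E : Type*} [NormedAddCommGroup E] [NormedSpace ℂ E]

/-- The (conditional) series `∑ a_n e_n` converges in norm. -/
def SeriesConverges (e : ℕ → E) (a : ℕ → ℂ) : Prop :=
  Summable (fun n => a n • e n) (SummationFilter.conditional ℕ)

/-- A Schauder basis `(e_n)` is symmetric if, for every permutation `σ` of the indices,
`(e_{σ n})` is a Schauder basis which is equivalent to `(e_n)`. -/
def IsSymmetricBasis (e : SchauderBasis ℂ E) : Prop :=
  ∀ σ : Equiv.Perm ℕ,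
    (∃ b : SchauderBasis ℂ E, ∀ n, b n = e (σ n)) ∧
      ∀ a : ℕ → ℂ, SeriesConverges (fun n => e (σ n)) a ↔ SeriesConverges e a

/-- The coefficient sequences `c` of the formal series `∑ c_n e_n` for which
`∑ (Δ^k c)_n e_n` converges in `E`. -/
def formalSubmodule (e : SchauderBasis ℂ E) (k : ℕ) : Submodule ℂ (ℕ → ℂ) where
  carrier := {c | SeriesConverges e ((diff ^ k) c)}
  zero_mem' := by simp [SeriesConverges, summable_zero]
  add_mem' {c d} hc hd := by
    simpa [SeriesConverges, add_smul] using Summable.add hc hd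
  smul_mem' a c hc := by
    simpa [SeriesConverges, mul_smul] using Summable.const_smul a hc

/-- The space of formal series `x = ∑ c_n e_n` for which `∑ (Δ^k c)_n e_n` converges in `E`; its norm
is `‖x‖ = ‖∑ (Δ^k c)_n e_n‖`.  (A type synonym: it does not carry the topology of pointwise
convergence of the coefficients.) -/
def FormalSpace (e : SchauderBasis ℂ E) (k : ℕ) : Type := formalSubmodule e k

namespace FormalSpace

variable {e : SchauderBasis ℂ E} {k : ℕ}

instance : AddCommGroup (FormalSpace e k) := inferInstanceAs (AddCommGroup (formalSubmodule e k))
instance : Module ℂ (FormalSpace e k) := inferInstanceAs (Module ℂ (formalSubmodule e k))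

/-- The coefficient sequence of a formal series. -/
def coeff : FormalSpace e k →ₗ[ℂ] (ℕ → ℂ) := (formalSubmodule e k).subtype

/-- The formal series with a given coefficient sequence. -/
def mk (c : ℕ → ℂ) (hc : c ∈ formalSubmodule e k) : FormalSpace e k := ⟨c, hc⟩

/-- The sum `∑ (Δ^k c)_n e_n` in `E`, as a function of the formal series `∑ c_n e_n`. -/
def toSum : FormalSpace e k →ₗ[ℂ] E where
  toFun x := ∑'[SummationFilter.conditional ℕ] n, ((diff ^ k) (coeff x)) n • e n
  map_add' x y := by
    have hx : Summable (fun n => ((diff ^ k) (coeff x)) n • e n) (SummationFilter.conditional ℕ) :=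
      x.2
    have hy : Summable (fun n => ((diff ^ k) (coeff y)) n • e n) (SummationFilter.conditional ℕ) :=
      y.2
    rw [← hx.tsum_add hy]
    simp [add_smul]
  map_smul' a x := by
    have hx : Summable (fun n => ((diff ^ k) (coeff x)) n • e n) (SummationFilter.conditional ℕ) :=
      x.2
    rw [RingHom.id_apply, ← hx.tsum_const_smul a]
    simp [mul_smul]

theorem hasSum_toSum (x : FormalSpace e k) :
    HasSum (fun n => ((diff ^ k) (coeff x)) n • e n) (toSum x) (SummationFilter.conditional ℕ) :=
  Summable.hasSum x.2

theorem diff_injective : Function.Injective diff := by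
  rw [injective_iff_map_eq_zero]
  intro c hc
  funext n
  induction n with
  | zero => simpa [diff] using congrFun hc 0
  | succ m ih => simpa [diff, ih] using congrFun hc (m + 1)

theorem toSum_injective : Function.Injective (toSum : FormalSpace e k →ₗ[ℂ] E) := by
  rw [injective_iff_map_eq_zero]
  intro x hx
  have h := hasSum_toSum x
  rw [hx] at h
  have hz : (diff ^ k) (coeff x) = 0 := by
    funext m
    have h1 := h.mapL (e.coord m)
    have h2 : HasSum (fun n => e.coord m (((diff ^ k) (coeff x)) n • e n))
        (((diff ^ k) (coeff x)) m) (SummationFilter.conditional ℕ) := by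
      have := hasSum_single (L := SummationFilter.conditional ℕ)
        (f := fun n => e.coord m (((diff ^ k) (coeff x)) n • e n)) m
        (fun n hn => by simp [e.ortho, hn.symm])
      simpa [e.ortho] using this
    simpa using h2.unique h1
  have hinj : Function.Injective (diff ^ k) := by
    rw [Module.End.coe_pow]
    exact diff_injective.iterate k
  exact Subtype.ext (hinj (hz.trans (map_zero (diff ^ k)).symm))

instance : NormedAddCommGroup (FormalSpace e k) :=
  NormedAddCommGroup.induced (FormalSpace e k) E toSum toSum_injective

instance : NormedSpace ℂ (FormalSpace e k) :=
  NormedSpace.induced ℂ (FormalSpace e k) E toSum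

end FormalSpace

/-- The operator `A ∑ c_n e_n = ∑ i f(n) c_n e_n` on the space of formal series, with domain the set of
all `x = ∑ c_n e_n` in the space such that `∑ f(n) c_n e_n` belongs to the space. -/
def diagOp (e : SchauderBasis ℂ E) (k : ℕ) (f : ℝ → ℝ) :
    FormalSpace e k →ₗ.[ℂ] FormalSpace e k where
  domain :=
    { carrier := {x | (fun n : ℕ => (f (n + 1) : ℂ) * FormalSpace.coeff x n) ∈ formalSubmodule e k}
      zero_mem' := by
        have h : (fun n : ℕ => (f (n + 1) : ℂ) * FormalSpace.coeff (0 : FormalSpace e k) n) = 0 := by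
          funext n
          simp
        rw [Set.mem_ofPred_eq, h]
        exact (formalSubmodule e k).zero_mem
      add_mem' := by
        intro x y hx hy
        have h := (formalSubmodule e k).add_mem hx hy
        simpa [Pi.add_def, mul_add] using h
      smul_mem' := by
        intro a x hx
        have h := (formalSubmodule e k).smul_mem a hx
        simpa [Pi.smul_def, mul_left_comm] using h }
  toFun :=
    { toFun := fun x => Complex.I •
        FormalSpace.mk (fun n : ℕ => (f (n + 1) : ℂ) * FormalSpace.coeff x.1 n) x.2
      map_add' := by
        intro x y
        rw [← smul_add]
        congr 1
        apply Subtype.ext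
        funext n
        exact (congrArg _ (congrFun (map_add FormalSpace.coeff x.1 y.1) n)).trans (mul_add _ _ _)
      map_smul' := by
        intro a x
        rw [RingHom.id_apply, smul_comm a]
        congr 1
        apply Subtype.ext
        funext n
        exact (congrArg _ (congrFun (map_smul FormalSpace.coeff a x.1) n)).trans
          (mul_left_comm _ _ _) }

/-- `(U t)_{t ∈ ℝ}` is a strongly continuous one-parameter group of bounded operators. -/
structure IsC0Group (U : ℝ → E →L[ℂ] E) : Prop where
  map_zero : U 0 = ContinuousLinearMap.id ℂ E
  map_add : ∀ s t, U (s + t) = (U s).comp (U t)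
  continuous : ∀ x, Continuous fun t => U t x

/-- The (possibly unbounded) operator `A` generates a C₀-group `U`: `x` lies in the domain of `A` and
`A x = y` if and only if `(U t x - x) / t → y` as `t → 0`. -/
def GeneratesC0Group (A : E →ₗ.[ℂ] E) : Prop :=
  ∃ U : ℝ → E →L[ℂ] E, IsC0Group U ∧
    ∀ x y : E, (x, y) ∈ A.graph ↔
      Tendsto (fun t : ℝ => ((t : ℂ)⁻¹) • (U t x - x)) (𝓝[≠] 0) (𝓝 y)

end General

/-- The class `𝒮_k` of real functions on `[1, ∞)` (only the values on `[1, ∞)` matter): `f(x) → +∞` as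
`x → ∞`, and `n^k |f(n-j) - f(n)|` has a finite limit as `n → ∞` for `j = 1, …, k`. -/
def S (k : ℕ) : Set (ℝ → ℝ) :=
  {f | Tendsto f atTop atTop ∧
    ∀ j : ℕ, 1 ≤ j → j ≤ k → ∃ L : ℝ,
      Tendsto (fun n : ℕ => (n : ℝ) ^ k * |f ((n : ℝ) - j) - f n|) atTop (𝓝 L)}

/-- `n^k |f(n-j) - f(n)|`, `n > j`, is bounded for `j = 1, …, k`. -/
def BoundedDiffs (k : ℕ) (f : ℝ → ℝ) : Prop :=
  ∀ j : ℕ, 1 ≤ j → j ≤ k → ∃ C : ℝ,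
    ∀ n : ℕ, j < n → (n : ℝ) ^ k * |f ((n : ℝ) - j) - f n| ≤ C

end DiagonalGroup

end

/-! The first pillar is that a symmetric basis of `ℓ_p` is equivalent to the unit vector basis
(`IsSymmetricBasis.summable_iff_memℓp`). Such a basis is unconditional and insensitive to passing to
a subsequence, so `∑ a_j e_j` converges exactly when `∑ a_j (e_{m_j} - e_{n_j})` does. A gliding
hump makes these differences a norm-summable perturbation of disjointly supported blocks with norms
bounded above and below, and such blocks behave like unit vectors. Hence the space of formal series
is `ℓ_p` transported by `Δ^k`.

The constant sequence 1 lies in this space because `Δ1` has finite support. Its expansion in the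
unit vectors would have terms of norm bounded away from zero, so they are not a basis. The
completion claim reduces to density of the range of `I - T`, which averaging gives for `p > 1`.

The second pillar is a commutator estimate. The group multiplies coefficients by `φ_n = exp(i t
f(n))`, and `|φ_n - φ_{n-1}| ≤ |t| C / n^k`. Then `Δ^k(φc) - φ Δ^k c` is dominated by a multiple of
`|t|` times the Cesàro means of `|Δ^k c|` (`norm_diff_pow_mul_sub_le`), which lie in `ℓ_p` by
Hardy's inequality, as `p > 1`. This makes the multiplications well defined, bounded by the closed
graph theorem, and strongly continuous by dominated convergence. The generator is identified
coefficient by coefficient. -/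

namespace DiagonalGroup

/-! ### Rearrangements and unconditional convergence. -/

/-- Enumerate `ℕ` by the stage at which a number enters the chain, then by size. Each `F j` is an
initial segment of this order, and `σ i` is its `i`-th element. -/
theorem exists_perm_image_range (F : ℕ → Finset ℕ) (hF : Monotone F) (hex : ∀ n, ∃ j, n ∈ F j) :
    ∃ σ : Equiv.Perm ℕ, ∀ j, (Finset.range (F j).card).image σ = F j := by
  classical
  let r : ℕ → ℕ := fun n => Nat.find (hex n)
  have hr : ∀ n, n ∈ F (r n) := fun n => Nat.find_spec (hex n)
  have hr' : ∀ n j, n ∈ F j → r n ≤ j := fun n j h => Nat.find_min' (hex n) h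
  let L : ℕ → ℕ := fun j => ∑ i ∈ Finset.range j, ((F i).sup id + 1)
  have hL : Monotone L := fun a b h =>
    Finset.sum_le_sum_of_subset (Finset.range_mono h)
  -- The offset `L (r n)` exceeds every value of `g` at earlier stages, so `g` encodes the
  -- lexicographic order of `(r n, n)`.
  let g : ℕ → ℕ := fun n => L (r n) + n
  have hg1 : ∀ n, g n < L (r n + 1) := by
    intro n
    have : n ≤ (F (r n)).sup id := Finset.le_sup (f := id) (hr n)
    simp only [g, L, Finset.sum_range_succ]
    omega
  have hmem : ∀ n j, n ∈ F j ↔ g n < L (j + 1) := by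
    intro n j
    refine ⟨fun h => (hg1 n).trans_le (hL (Nat.succ_le_succ (hr' n j h))), fun h => ?_⟩
    by_contra hn
    have : j < r n := by
      by_contra h'
      exact hn (hF (not_lt.1 h') (hr n))
    have h2 : L (j + 1) ≤ L (r n) := hL this
    have h3 : L (r n) ≤ g n := Nat.le_add_right _ _
    omega
  have hg : Function.Injective g := by
    intro a b hab
    have key : ∀ a b, g a = g b → r a ≤ r b := by
      intro a b h
      exact hr' a _ ((hmem a (r b)).2 (h ▸ hg1 b))
    have hrr : r a = r b := le_antisymm (key a b hab) (key b a hab.symm)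
    simp only [g, hrr] at hab
    omega
  have : Infinite (Set.range g) := (Set.infinite_range_of_injective hg).to_subtype
  let o : ℕ ≃o Set.range g := Nat.Subtype.orderIsoOfNat (Set.range g)
  let σ : Equiv.Perm ℕ := o.toEquiv.trans (Equiv.ofInjective g hg).symm
  have hσ : ∀ i, g (σ i) = (o i : ℕ) := fun i => by
    have := Equiv.apply_ofInjective_symm hg (o i)
    simpa [σ] using this
  refine ⟨σ, fun j => ?_⟩
  have hlow : ∀ i i', i ≤ i' → σ i' ∈ F j → σ i ∈ F j := by
    intro i i' h hi
    rw [hmem, hσ] at hi ⊢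
    exact lt_of_le_of_lt (o.monotone h) hi
  have hsub : Finset.range (F j).card ⊆ (F j).map σ.symm.toEmbedding := by
    intro i hi
    by_contra hni
    have hs : (F j).map σ.symm.toEmbedding ⊆ Finset.range i := by
      intro i' hi'
      rw [Finset.mem_range]
      by_contra hle
      apply hni
      rw [Finset.mem_map_equiv, Equiv.symm_symm] at hi' ⊢
      exact hlow i i' (not_lt.1 hle) hi'
    have := Finset.card_le_card hs
    rw [Finset.card_map, Finset.card_range] at this
    rw [Finset.mem_range] at hi
    omega
  have heq := Finset.eq_of_subset_of_card_le hsub (by simp)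
  ext n
  rw [heq]
  simp only [Finset.mem_image, Finset.mem_map_equiv, Equiv.symm_symm]
  exact ⟨by rintro ⟨a, h, rfl⟩; exact h, fun h => ⟨σ.symm n, by simpa using h, by simp⟩⟩

section Complete

variable {E : Type*} [NormedAddCommGroup E]

theorem summable_conditional_iff {f : ℕ → E} :
    Summable f (SummationFilter.conditional ℕ) ↔
      ∃ x, Tendsto (fun n => ∑ i ∈ Finset.range n, f i) atTop (𝓝 x) := by
  simp only [Summable, HasSum, SummationFilter.conditional_filter_eq_map_range, tendsto_map'_iff]
  rfl

variable [CompleteSpace E]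

theorem summable_iff_summable_indicator {f : ℕ → E} (A : Set ℕ) :
    Summable f ↔ Summable (A.indicator f) ∧ Summable (Aᶜ.indicator f) := by
  refine ⟨fun h => ⟨h.indicator A, h.indicator Aᶜ⟩, fun h => ?_⟩
  have := h.1.add h.2
  rw [← Set.indicator_self_add_compl A f]
  exact this

/-- If the unordered Cauchy criterion fails, there are finite sets `t N` beyond every `N` with sums
of norm at least `ε`. A rearrangement that completes each `t N` right after an initial segment is
not Cauchy. -/
theorem summable_of_forall_perm {f : ℕ → E}
    (h : ∀ σ : Equiv.Perm ℕ, Summable (fun n => f (σ n)) (SummationFilter.conditional ℕ)) :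
    Summable f := by
  classical
  by_contra hf
  rw [summable_iff_vanishing_norm] at hf
  push Not at hf
  obtain ⟨ε, hε, hf⟩ := hf
  choose t htd ht using fun N => hf (Finset.range N)
  let nx : ℕ → ℕ := fun N => N + (t N).sup id + 1
  let N : ℕ → ℕ := fun k => nx^[k] 0
  have hN : ∀ k, N (k + 1) = N k + (t (N k)).sup id + 1 := fun k => by
    simp only [N, Function.iterate_succ_apply', nx]
  have hNk : ∀ k, k ≤ N k := by
    intro k
    induction k with
    | zero => exact Nat.zero_le _
    | succ k ih => rw [hN]; omega
  have ht1 : ∀ k, t (N k) ⊆ Finset.range (N (k + 1)) := by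
    intro k i hi
    have : i ≤ (t (N k)).sup id := Finset.le_sup (f := id) hi
    rw [Finset.mem_range, hN]; omega
  let F : ℕ → Finset ℕ := fun j =>
    if j % 2 = 0 then Finset.range (N (j / 2)) else Finset.range (N (j / 2)) ∪ t (N (j / 2))
  have hF0 : ∀ k, F (2 * k) = Finset.range (N k) := fun k => by
    simp [F]
  have hF1 : ∀ k, F (2 * k + 1) = Finset.range (N k) ∪ t (N k) := fun k => by
    have h1 : (2 * k + 1) % 2 = 1 := by omega
    have h2 : (2 * k + 1) / 2 = k := by omega
    simp [F, h1, h2]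
  have hFm : Monotone F := by
    refine monotone_nat_of_le_succ fun j => ?_
    obtain ⟨k, hk | hk⟩ := Nat.even_or_odd' j
    · rw [hk, hF0, hF1]; exact Finset.subset_union_left
    · rw [hk, hF1, show 2 * k + 1 + 1 = 2 * (k + 1) by ring, hF0]
      refine Finset.union_subset (Finset.range_mono ?_) (ht1 k)
      rw [hN]; omega
  obtain ⟨σ, hσ⟩ := exists_perm_image_range F hFm fun n => ⟨2 * (n + 1), by
    rw [hF0, Finset.mem_range]; exact hNk (n + 1)⟩
  obtain ⟨x, hx⟩ := summable_conditional_iff.1 (h σ)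
  have hsum : ∀ j, ∑ i ∈ Finset.range (F j).card, f (σ i) = ∑ i ∈ F j, f i := by
    intro j
    conv_rhs => rw [← hσ j]
    rw [Finset.sum_image (fun a _ b _ hab => σ.injective hab)]
  obtain ⟨M, hM⟩ := Metric.cauchySeq_iff.1 hx.cauchySeq ε hε
  have h0 : M ≤ (F (2 * M)).card := by rw [hF0, Finset.card_range]; exact hNk M
  have h1 : M ≤ (F (2 * M + 1)).card := h0.trans (Finset.card_le_card (hFm (Nat.le_succ _)))
  have hd := hM _ h1 _ h0
  rw [hsum, hsum, hF0, hF1, Finset.sum_union (htd (N M)).symm, dist_eq_norm,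
    add_sub_cancel_left] at hd
  exact absurd hd (not_lt.2 (ht (N M)))

end Complete

/-! ### Symmetric bases: unconditionality, subsequences, norm bounds. -/

section Symmetric

variable {E : Type*} [NormedAddCommGroup E] [NormedSpace ℂ E]

theorem coord_eq_of_hasSum (e : SchauderBasis ℂ E) {a : ℕ → ℂ} {x : E}
    (h : HasSum (fun n => a n • e n) x (SummationFilter.conditional ℕ)) (m : ℕ) :
    e.coord m x = a m := by
  have h1 := h.mapL (e.coord m)
  have h2 : HasSum (fun n => e.coord m (a n • e n)) (a m) (SummationFilter.conditional ℕ) := by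
    have := hasSum_single (L := SummationFilter.conditional ℕ)
      (f := fun n => e.coord m (a n • e n)) m (fun n hn => by simp [e.ortho, hn.symm])
    simpa [e.ortho] using this
  exact h1.unique h2

theorem ext_coord (e : SchauderBasis ℂ E) {x y : E} (h : ∀ n, e.coord n x = e.coord n y) :
    x = y := by
  have hx := e.expansion x
  simp_rw [h] at hx
  exact hx.unique (e.expansion y)

theorem coord_comp_perm (e b : SchauderBasis ℂ E) (σ : Equiv.Perm ℕ) (hb : ∀ n, b n = e (σ n))
    (n : ℕ) (x : E) : b.coord n x = e.coord (σ n) x := by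
  have h1 := (e.expansion x).mapL (b.coord n)
  have h2 : HasSum (fun m => b.coord n (e.coord m x • e m)) (e.coord (σ n) x)
      (SummationFilter.conditional ℕ) := by
    have he : ∀ m, e m = b (σ.symm m) := fun m => by rw [hb, Equiv.apply_symm_apply]
    have := hasSum_single (L := SummationFilter.conditional ℕ)
      (f := fun m => b.coord n (e.coord m x • e m)) (σ n) (fun m hm => by
        have : n ≠ σ.symm m := fun h => hm (by rw [h, Equiv.apply_symm_apply])
        rw [he m, map_smul, b.ortho]
        simp [this])
    rw [he (σ n), map_smul, b.ortho] at this
    simpa using this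
  exact h1.unique h2

variable [CompleteSpace E] {e : SchauderBasis ℂ E}

namespace IsSymmetricBasis

theorem summable_coord (he : IsSymmetricBasis e) (x : E) :
    Summable fun n => e.coord n x • e n := by
  refine summable_of_forall_perm fun σ => ?_
  obtain ⟨b, hb⟩ := (he σ).1
  have := (b.expansion x).summable
  simpa only [hb, coord_comp_perm e b σ hb] using this

theorem seriesConverges_iff_summable (he : IsSymmetricBasis e) (a : ℕ → ℂ) :
    SeriesConverges e a ↔ Summable fun n => a n • e n := by
  refine ⟨fun ⟨x, hx⟩ => ?_, fun h => ?_⟩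
  · have := he.summable_coord x
    simpa only [coord_eq_of_hasSum e hx] using this
  · exact summable_conditional_iff.2 ⟨_, h.hasSum.tendsto_sum_nat⟩

theorem summable_perm_iff (he : IsSymmetricBasis e) (a : ℕ → ℂ) (σ : Equiv.Perm ℕ) :
    (Summable fun n => a n • e (σ n)) ↔ Summable fun n => a n • e n := by
  have h1 : (Summable fun n => a n • e (σ n)) ↔ SeriesConverges (fun n => e (σ n)) a := by
    refine ⟨fun h => summable_conditional_iff.2 ⟨_, h.hasSum.tendsto_sum_nat⟩, fun ⟨x, hx⟩ => ?_⟩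
    obtain ⟨b, hb⟩ := (he σ).1
    have h2 := coord_eq_of_hasSum b (by simpa only [hb] using hx)
    have := (he.summable_coord x).comp_injective σ.injective
    refine this.congr fun n => ?_
    simp only [Function.comp, ← coord_comp_perm e b σ hb, h2]
  rw [h1, (he σ).2, he.seriesConverges_iff_summable]

end IsSymmetricBasis

/-- The complement of `φ '' A` contains `φ '' Aᶜ`, so both complements are countably infinite and
any bijection between them completes `φ`. -/
theorem exists_perm_eqOn {φ : ℕ → ℕ} (hφ : Function.Injective φ) {A : Set ℕ}
    (hAc : Aᶜ.Infinite) : ∃ σ : Equiv.Perm ℕ, ∀ n ∈ A, σ n = φ n := by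
  classical
  have hB : (φ '' A)ᶜ.Infinite := by
    refine (hAc.image hφ.injOn).mono ?_
    rintro _ ⟨n, hn, rfl⟩ ⟨m, hm, h⟩
    exact hn (hφ h ▸ hm)
  have : Infinite ↑Aᶜ := hAc.to_subtype
  have : Infinite ↑(φ '' A)ᶜ := hB.to_subtype
  obtain ⟨ψ⟩ := nonempty_equiv_of_countable (α := ↑Aᶜ) (β := ↑(φ '' A)ᶜ)
  refine ⟨(Equiv.Set.sumCompl A).symm.trans (((Equiv.Set.image φ A hφ).sumCongr ψ).trans
    (Equiv.Set.sumCompl (φ '' A))), fun n hn => ?_⟩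
  simp [Equiv.Set.sumCompl_symm_apply_of_mem hn]

namespace IsSymmetricBasis

/-- An injection need not extend to a permutation, but its restrictions to the even and to the odd
indices do. Unconditional convergence allows the two halves to be treated separately. -/
theorem summable_comp_iff (he : IsSymmetricBasis e) (a : ℕ → ℂ) {φ : ℕ → ℕ}
    (hφ : Function.Injective φ) :
    (Summable fun n => a n • e (φ n)) ↔ Summable fun n => a n • e n := by
  have key : ∀ A : Set ℕ, Aᶜ.Infinite →
      (Summable (A.indicator fun n => a n • e (φ n)) ↔
        Summable (A.indicator fun n => a n • e n)) := by
    intro A hAc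
    obtain ⟨σ, hσ⟩ := exists_perm_eqOn hφ hAc
    have h1 : (A.indicator fun n => a n • e (φ n)) = fun n => A.indicator a n • e (σ n) := by
      funext n
      by_cases hn : n ∈ A <;> simp [hn, hσ]
    have h2 : (A.indicator fun n => a n • e n) = fun n => A.indicator a n • e n := by
      funext n
      by_cases hn : n ∈ A <;> simp [hn]
    rw [h1, h2, he.summable_perm_iff]
  have hev : {n : ℕ | Even n}.Infinite :=
    Set.infinite_of_injective_forall_mem (f := fun n : ℕ => 2 * n)
      (fun a b h => by simpa using h) (fun n => by simp)
  have hod : {n : ℕ | Even n}ᶜ.Infinite :=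
    Set.infinite_of_injective_forall_mem (f := fun n : ℕ => 2 * n + 1)
      (fun a b h => by simpa using h) (fun n => by simp)
  rw [summable_iff_summable_indicator {n : ℕ | Even n}, key _ hod,
    key _ (by rwa [compl_compl]), ← summable_iff_summable_indicator]

/-- Otherwise a subsequence grows so fast that weights making `∑ a_j e_j` absolutely convergent
leave the terms `a_j e_{φ j}` of norm above 1, against invariance under subsequences. The lower
bound below is dual to this. -/
theorem exists_eventually_norm_le (he : IsSymmetricBasis e) : ∃ C : ℝ, ∀ᶠ n in atTop, ‖e n‖ ≤ C := by
  by_contra! h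
  obtain ⟨φ, hφ, hφ'⟩ := extraction_forall_of_frequently
    (P := fun j n => 2 ^ j * (1 + ‖e j‖) < ‖e n‖) fun j => h _
  let a : ℕ → ℂ := fun j => ((2 ^ j * (1 + ‖e j‖) : ℝ) : ℂ)⁻¹
  have hpos : ∀ j, 0 < 2 ^ j * (1 + ‖e j‖) := fun j => by positivity
  have hna : ∀ j, ‖a j‖ = (2 ^ j * (1 + ‖e j‖))⁻¹ := fun j => by
    rw [norm_inv, Complex.norm_of_nonneg (hpos j).le]
  have h1 : Summable fun j => a j • e j := by
    refine Summable.of_norm_bounded (g := fun j : ℕ => (1 / 2 : ℝ) ^ j) summable_geometric_two ?_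
    intro j
    rw [norm_smul, hna, inv_mul_le_iff₀ (hpos j), one_div, inv_pow, mul_comm (2 ^ j), mul_assoc,
      mul_inv_cancel₀ (by positivity)]
    linarith
  have h2 := ((he.summable_comp_iff a hφ.injective).2 h1).tendsto_atTop_zero
  obtain ⟨j, hj⟩ := ((tendsto_order.1 (tendsto_norm_zero.comp h2)).2 1 one_pos).exists
  simp only [Function.comp, norm_smul, hna] at hj
  rw [inv_mul_lt_iff₀ (hpos j), mul_one] at hj
  exact absurd hj (hφ' j).le.not_gt

theorem exists_eventually_le_norm (he : IsSymmetricBasis e) :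
    ∃ δ : ℝ, 0 < δ ∧ ∀ᶠ n in atTop, δ ≤ ‖e n‖ := by
  by_contra! h
  have hpos : ∀ j, 0 < ‖e j‖ := fun j => norm_pos_iff.2 fun h0 => by
    have := e.ortho j j
    rw [h0] at this
    simp at this
  obtain ⟨φ, hφ, hφ'⟩ := extraction_forall_of_frequently
    (P := fun j n => ‖e n‖ < (1 / 2) ^ j * ‖e j‖) fun j => h _ (mul_pos (by positivity) (hpos j))
  let a : ℕ → ℂ := fun j => (‖e j‖ : ℂ)⁻¹
  have hna : ∀ j, ‖a j‖ = ‖e j‖⁻¹ := fun j => by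
    rw [norm_inv, Complex.norm_of_nonneg (hpos j).le]
  have h1 : Summable fun j => a j • e (φ j) := by
    refine Summable.of_norm_bounded (g := fun j : ℕ => (1 / 2 : ℝ) ^ j) summable_geometric_two ?_
    intro j
    rw [norm_smul, hna, inv_mul_le_iff₀ (hpos j), mul_comm]
    exact (hφ' j).le
  have h2 := ((he.summable_comp_iff a hφ.injective).1 h1).tendsto_atTop_zero
  obtain ⟨j, hj⟩ := ((tendsto_order.1 (tendsto_norm_zero.comp h2)).2 1 one_pos).exists
  simp only [Function.comp, norm_smul, hna] at hj
  rw [inv_mul_cancel₀ (hpos j).ne'] at hj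
  exact lt_irrefl _ hj

end IsSymmetricBasis

end Symmetric

/-! ### Symmetric bases of `ℓ_p` are equivalent to the unit vector basis. -/

section Blocks

variable {p : ℝ≥0∞}

/-- The restriction of a sequence to a finite set of indices. -/
noncomputable def restrict (I : Finset ℕ) (x : lp (fun _ : ℕ => ℂ) p) : lp (fun _ : ℕ => ℂ) p :=
  ∑ i ∈ I, lp.single p i (x i)

theorem restrict_apply (I : Finset ℕ) (x : lp (fun _ : ℕ => ℂ) p) (i : ℕ) :
    restrict I x i = if i ∈ I then x i else 0 := by
  rw [restrict, lp.coeFn_sum, Finset.sum_apply]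
  simp [lp.single_apply, Pi.single_apply]

theorem restrict_Ico (x : lp (fun _ : ℕ => ℂ) p) {M N : ℕ} (h : M ≤ N) :
    restrict (Finset.Ico M N) x = restrict (Finset.range N) x - restrict (Finset.range M) x :=
  Finset.sum_Ico_eq_sub _ h

variable [Fact (1 ≤ p)]

theorem toReal_pos_of_ne_top (hp' : p ≠ ⊤) : 0 < p.toReal :=
  ENNReal.toReal_pos (zero_lt_one.trans_le Fact.out).ne' hp'

theorem norm_add_rpow_of_disjoint (hp' : p ≠ ⊤) {x y : lp (fun _ : ℕ => ℂ) p}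
    (h : ∀ i, x i = 0 ∨ y i = 0) :
    ‖x + y‖ ^ p.toReal = ‖x‖ ^ p.toReal + ‖y‖ ^ p.toReal := by
  have hp0 := toReal_pos_of_ne_top hp'
  refine (lp.hasSum_norm hp0 (x + y)).unique ?_
  convert (lp.hasSum_norm hp0 x).add (lp.hasSum_norm hp0 y) using 2 with i
  rw [lp.coeFn_add, Pi.add_apply]
  rcases h i with h | h <;> simp [h, Real.zero_rpow hp0.ne']

theorem norm_sum_rpow_of_disjoint (hp' : p ≠ ⊤) {w : ℕ → lp (fun _ : ℕ => ℂ) p}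
    (h : ∀ j j', j ≠ j' → ∀ i, w j i = 0 ∨ w j' i = 0) (F : Finset ℕ) :
    ‖∑ j ∈ F, w j‖ ^ p.toReal = ∑ j ∈ F, ‖w j‖ ^ p.toReal := by
  classical
  induction F using Finset.induction_on with
  | empty => simp [Real.zero_rpow (toReal_pos_of_ne_top hp').ne']
  | insert j F hj ih =>
    rw [Finset.sum_insert hj, Finset.sum_insert hj, norm_add_rpow_of_disjoint hp', ih]
    intro i
    by_cases hji : w j i = 0
    · exact Or.inl hji
    · right
      rw [lp.coeFn_sum, Finset.sum_apply]
      refine Finset.sum_eq_zero fun j' hj' => ?_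
      exact (h j j' (fun hjj => hj (hjj ▸ hj')) i).resolve_left hji

theorem summable_iff_of_disjoint (hp' : p ≠ ⊤) {w : ℕ → lp (fun _ : ℕ => ℂ) p}
    (h : ∀ j j', j ≠ j' → ∀ i, w j i = 0 ∨ w j' i = 0) :
    Summable w ↔ Summable fun j => ‖w j‖ ^ p.toReal := by
  have hp0 := toReal_pos_of_ne_top hp'
  rw [summable_iff_vanishing_norm, summable_iff_vanishing_norm]
  have hn : ∀ t : Finset ℕ, ‖∑ j ∈ t, ‖w j‖ ^ p.toReal‖ = ‖∑ j ∈ t, w j‖ ^ p.toReal := fun t => by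
    rw [norm_sum_rpow_of_disjoint hp' h, Real.norm_of_nonneg]
    exact Finset.sum_nonneg fun _ _ => by positivity
  simp_rw [hn]
  constructor
  · intro H ε hε
    obtain ⟨s, hs⟩ := H (ε ^ (p.toReal)⁻¹) (by positivity)
    refine ⟨s, fun t ht => ?_⟩
    have := Real.rpow_lt_rpow (norm_nonneg _) (hs t ht) hp0
    rwa [← Real.rpow_mul hε.le, inv_mul_cancel₀ hp0.ne', Real.rpow_one] at this
  · intro H ε hε
    obtain ⟨s, hs⟩ := H (ε ^ p.toReal) (by positivity)
    exact ⟨s, fun t ht => (Real.rpow_lt_rpow_iff (norm_nonneg _) hε.le hp0).1 (hs t ht)⟩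

theorem summable_smul_iff_of_disjoint (hp' : p ≠ ⊤) {w : ℕ → lp (fun _ : ℕ => ℂ) p}
    (h : ∀ j j', j ≠ j' → ∀ i, w j i = 0 ∨ w j' i = 0) {δ C : ℝ} (hδ : 0 < δ)
    (hw : ∀ j, δ ≤ ‖w j‖) (hw' : ∀ j, ‖w j‖ ≤ C) (a : ℕ → ℂ) :
    (Summable fun j => a j • w j) ↔ Memℓp a p := by
  have hp0 := toReal_pos_of_ne_top hp'
  have hC : 0 ≤ C := (norm_nonneg _).trans (hw' 0)
  rw [summable_iff_of_disjoint hp', memℓp_gen_iff hp0]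
  · have hn : ∀ j, ‖a j • w j‖ ^ p.toReal = ‖a j‖ ^ p.toReal * ‖w j‖ ^ p.toReal := fun j => by
      rw [norm_smul, Real.mul_rpow (norm_nonneg _) (norm_nonneg _)]
    constructor
    · intro H
      refine Summable.of_nonneg_of_le (fun _ => by positivity) (fun j => ?_)
        (H.mul_right (δ ^ p.toReal)⁻¹)
      rw [hn, ← div_eq_mul_inv, le_div_iff₀ (by positivity)]
      gcongr
      exact hw j
    · intro H
      refine Summable.of_nonneg_of_le (fun _ => by positivity) (fun j => ?_)
        (H.mul_right (C ^ p.toReal))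
      rw [hn]
      gcongr
      exact hw' j
  · intro j j' hj i
    rcases h j j' hj i with h | h
    · left; simp [h]
    · right; simp [h]

theorem tendsto_restrict_range (hp' : p ≠ ⊤) (x : lp (fun _ : ℕ => ℂ) p) :
    Tendsto (fun N => restrict (Finset.range N) x) atTop (𝓝 x) :=
  (lp.hasSum_single hp' x).tendsto_sum_nat

theorem norm_restrict_le (I : Finset ℕ) (x : lp (fun _ : ℕ => ℂ) p) :
    ‖restrict I x‖ ≤ ∑ i ∈ I, ‖x i‖ := by
  refine (norm_sum_le _ _).trans_eq (Finset.sum_congr rfl fun i _ => ?_)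
  exact lp.norm_single (E := fun _ : ℕ => ℂ) (zero_lt_one.trans_le Fact.out) i (x i)

variable {e : SchauderBasis ℂ (lp (fun _ : ℕ => ℂ) p)}

/-- The first `N` coordinates of a bounded sequence have a convergent subsequence. Taking
differences removes the need for the vectors themselves to tend to zero coordinatewise. -/
theorem exists_sub_norm_restrict_lt {u : ℕ → lp (fun _ : ℕ => ℂ) p} {C : ℝ}
    (hu : ∀ᶠ n in atTop, ‖u n‖ ≤ C) (N : ℕ) {ε : ℝ} (hε : 0 < ε) :
    ∃ m n, N ≤ m ∧ m < n ∧ ‖restrict (Finset.range N) (u m - u n)‖ < ε := by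
  let G : ℕ → (Fin N → ℂ) := fun n i => u n i
  have hG : ∃ᶠ n in atTop, G n ∈ Metric.closedBall (0 : Fin N → ℂ) C := by
    refine Eventually.frequently (hu.mono fun n hn => ?_)
    rw [mem_closedBall_zero_iff, pi_norm_le_iff_of_nonneg ((norm_nonneg _).trans hn)]
    exact fun i => (lp.norm_apply_le_norm (zero_lt_one.trans_le Fact.out).ne' _ _).trans hn
  obtain ⟨g, -, φ, hφ, hlim⟩ := tendsto_subseq_of_frequently_bounded Metric.isBounded_closedBall hG
  have hε' : 0 < ε / (N + 1) := by positivity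
  obtain ⟨K, hK⟩ := Metric.cauchySeq_iff.1 hlim.cauchySeq _ hε'
  let k := max K N
  refine ⟨φ k, φ (k + 1), (le_max_right K N).trans (hφ.id_le k), hφ k.lt_succ_self, ?_⟩
  have hd := hK k (le_max_left _ _) (k + 1) ((le_max_left _ _).trans k.le_succ)
  rw [dist_eq_norm] at hd
  refine (norm_restrict_le _ _).trans_lt ?_
  have : ∀ i ∈ Finset.range N, ‖(u (φ k) - u (φ (k + 1))) i‖ ≤ ε / (N + 1) := by
    intro i hi
    have h1 := norm_le_pi_norm ((G ∘ φ) k - (G ∘ φ) (k + 1)) ⟨i, Finset.mem_range.1 hi⟩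
    exact (le_of_eq rfl).trans (h1.trans hd.le)
  refine (Finset.sum_le_sum this).trans_lt ?_
  rw [Finset.sum_const, Finset.card_range, nsmul_eq_mul, mul_div_assoc', div_lt_iff₀ (by positivity)]
  nlinarith

/-- For `m < n` the partial sum projection `e.proj (m + 1)` sends `e m - e n` to `e m`, and these
projections are uniformly bounded. -/
theorem exists_eventually_le_norm_sub {E : Type*} [NormedAddCommGroup E] [NormedSpace ℂ E]
    [CompleteSpace E] (e : SchauderBasis ℂ E) {δ : ℝ} (hδ : 0 < δ)
    (he : ∀ᶠ n in atTop, δ ≤ ‖e n‖) :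
    ∃ δ' > 0, ∀ᶠ m in atTop, ∀ n, m < n → δ' ≤ ‖e m - e n‖ := by
  obtain ⟨K, hK⟩ := e.exists_norm_proj_le
  have hK0 : 0 ≤ K := (norm_nonneg _).trans (hK 0)
  refine ⟨δ / (K + 1), by positivity, he.mono fun m hm n hmn => ?_⟩
  have h1 : e.proj (m + 1) (e m - e n) = e m := by
    rw [map_sub, e.proj_apply_basis_mem, e.proj_apply_basis_mem, if_pos m.lt_succ_self,
      if_neg (by omega), sub_zero]
  have h2 := (e.proj (m + 1)).le_of_opNorm_le (hK _) (e m - e n)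
  rw [h1] at h2
  rw [div_le_iff₀ (by positivity)]
  nlinarith [norm_nonneg (e m - e n)]

/-- One step of the gliding hump: the head is small by the choice of `m` and `n`, the tail by taking
`N'` large. -/
theorem IsSymmetricBasis.exists_almost_block (hp' : p ≠ ⊤) (he : IsSymmetricBasis e) :
    ∃ δ > 0, ∃ C : ℝ, ∃ N₀ : ℕ, ∀ N, N₀ ≤ N → ∀ ε > 0, ∃ m n N', N ≤ m ∧ m < n ∧ n < N' ∧
      δ ≤ ‖e m - e n‖ ∧ ‖e m - e n‖ ≤ C ∧
      ‖(e m - e n) - restrict (Finset.Ico N N') (e m - e n)‖ ≤ ε := by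
  obtain ⟨C, hC⟩ := he.exists_eventually_norm_le
  obtain ⟨δ₀, hδ₀, hδ⟩ := he.exists_eventually_le_norm
  obtain ⟨δ, hδ0, hδ'⟩ := exists_eventually_le_norm_sub e hδ₀ hδ
  obtain ⟨N₀, hN₀⟩ := eventually_atTop.1 (hC.and hδ')
  refine ⟨δ, hδ0, C + C, N₀, fun N hN ε hε => ?_⟩
  obtain ⟨m, n, hm, hmn, hh⟩ := exists_sub_norm_restrict_lt hC N (half_pos hε)
  have ht := tendsto_restrict_range hp' (e m - e n)
  have ht' := (Metric.tendsto_nhds.1 ht (ε / 2) (half_pos hε)).and (eventually_gt_atTop n)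
  obtain ⟨N', hN', hn⟩ := ht'.exists
  refine ⟨m, n, N', hm, hmn, hn, (hN₀ m (hN.trans hm)).2 n hmn,
    (norm_sub_le _ _).trans (add_le_add (hN₀ m (hN.trans hm)).1
      (hN₀ n (hN.trans (hm.trans hmn.le))).1), ?_⟩
  rw [restrict_Ico _ (hm.trans (hmn.le.trans hn.le))]
  rw [dist_eq_norm, ← norm_neg, neg_sub] at hN'
  calc _ = ‖((e m - e n) - restrict (Finset.range N') (e m - e n))
        + restrict (Finset.range N) (e m - e n)‖ := by congr 1; abel
    _ ≤ _ := norm_add_le _ _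
    _ ≤ ε / 2 + ε / 2 := add_le_add hN'.le hh.le
    _ = ε := add_halves ε

/-- Convergence is passed from `e` to the differences `d j`, from these to their truncations `w j`,
and from the disjoint blocks `w j` to `a ∈ ℓ_p`. -/
theorem IsSymmetricBasis.summable_iff_memℓp (hp' : p ≠ ⊤) (he : IsSymmetricBasis e) (a : ℕ → ℂ) :
    (Summable fun n => a n • e n) ↔ Memℓp a p := by
  obtain ⟨δ, hδ, C, N₀, H⟩ := he.exists_almost_block hp'
  -- The geometric factor makes the truncation errors summable; the factor `δ / 2` keeps the
  -- truncated blocks of norm at least `δ / 2`.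
  let ε : ℕ → ℝ := fun N => (δ / 2) * (1 / 2) ^ N
  have hε : ∀ N, 0 < ε N := fun N => by positivity
  have H' : ∀ N, ∃ m n N', N₀ ≤ N → N ≤ m ∧ m < n ∧ n < N' ∧
      δ ≤ ‖e m - e n‖ ∧ ‖e m - e n‖ ≤ C ∧
      ‖(e m - e n) - restrict (Finset.Ico N N') (e m - e n)‖ ≤ ε N := fun N => by
    by_cases hN : N₀ ≤ N
    · obtain ⟨m, n, N', h⟩ := H N hN (ε N) (hε N)
      exact ⟨m, n, N', fun _ => h⟩
    -- A junk value, never reached since the iteration below starts at `N₀` and increases.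
    · exact ⟨0, 0, 0, fun h => absurd h hN⟩
  choose fm fn nx h using H'
  let N : ℕ → ℕ := fun j => nx^[j] N₀
  have hNs : ∀ j, N (j + 1) = nx (N j) := fun j => Function.iterate_succ_apply' nx j N₀
  have hN0 : ∀ j, N₀ ≤ N j := by
    intro j
    induction j with
    | zero => exact le_rfl
    | succ j ih => have := h (N j) ih; rw [hNs]; omega
  have hmono : StrictMono N := strictMono_nat_of_lt_succ fun j => by
    have := h (N j) (hN0 j); rw [hNs]; omega
  let m : ℕ → ℕ := fun j => fm (N j)
  let n : ℕ → ℕ := fun j => fn (N j)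
  let d : ℕ → lp (fun _ : ℕ => ℂ) p := fun j => e (m j) - e (n j)
  let w : ℕ → lp (fun _ : ℕ => ℂ) p := fun j => restrict (Finset.Ico (N j) (N (j + 1))) (d j)
  have hm : ∀ j, N j ≤ m j ∧ m j < n j ∧ n j < N (j + 1) ∧ δ ≤ ‖d j‖ ∧ ‖d j‖ ≤ C ∧
      ‖d j - w j‖ ≤ ε (N j) := fun j => by
    have := h (N j) (hN0 j)
    simpa only [← hNs] using this
  have hmm : StrictMono m := strictMono_nat_of_lt_succ fun j => by
    have := hm j; have := hm (j + 1); omega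
  have hnm : StrictMono n := strictMono_nat_of_lt_succ fun j => by
    have := hm j; have := hm (j + 1); omega
  have hmn : ∀ i j, m i ≠ n j := by
    intro i j hij
    have hi := hm i
    have hj := hm j
    rcases lt_trichotomy i j with hlt | rfl | hlt
    · have := hmono.monotone (Nat.succ_le_of_lt hlt)
      simp only [Nat.succ_eq_add_one] at this
      omega
    · omega
    · have := hmono.monotone (Nat.succ_le_of_lt hlt)
      simp only [Nat.succ_eq_add_one] at this
      omega
  have hdisj : ∀ j j', j ≠ j' → ∀ i, w j i = 0 ∨ w j' i = 0 := by
    intro j j' hjj i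
    simp only [w, restrict_apply, Finset.mem_Ico]
    by_contra! hcon
    have h1 := (ite_ne_right_iff.1 hcon.1).1
    have h2 := (ite_ne_right_iff.1 hcon.2).1
    rcases lt_or_gt_of_ne hjj with hlt | hlt
    · have := hmono.monotone (Nat.succ_le_of_lt hlt)
      simp only [Nat.succ_eq_add_one] at this
      omega
    · have := hmono.monotone (Nat.succ_le_of_lt hlt)
      simp only [Nat.succ_eq_add_one] at this
      omega
  have hεle : ∀ j, ε (N j) ≤ (δ / 2) * (1 / 2) ^ j := fun j => by
    refine mul_le_mul_of_nonneg_left ?_ (half_pos hδ).le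
    exact pow_le_pow_of_le_one (by norm_num) (by norm_num) (hmono.id_le j)
  have hεδ : ∀ j, ε (N j) ≤ δ / 2 := fun j => (hεle j).trans <|
    mul_le_of_le_one_right (half_pos hδ).le (pow_le_one₀ (by norm_num) (by norm_num))
  have hwl : ∀ j, δ / 2 ≤ ‖w j‖ := fun j => by
    have h1 := norm_sub_norm_le (d j) (w j)
    have := hm j
    linarith [hεδ j]
  have hwu : ∀ j, ‖w j‖ ≤ C + δ / 2 := fun j => by
    have h1 := norm_sub_norm_le (w j) (d j)
    rw [norm_sub_rev (w j) (d j)] at h1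
    have := hm j
    linarith [hεδ j]
  have hpert : ∀ B : ℝ, (∀ j, ‖a j‖ ≤ B) → Summable fun j => a j • (d j - w j) := by
    intro B hB
    have hB0 : 0 ≤ B := (norm_nonneg _).trans (hB 0)
    refine Summable.of_norm_bounded (g := fun j : ℕ => B * ((δ / 2) * (1 / 2 : ℝ) ^ j))
      ((summable_geometric_two.mul_left _).mul_left _) fun j => ?_
    rw [norm_smul]
    exact mul_le_mul (hB j) ((hm j).2.2.2.2.2.trans (hεle j)) (norm_nonneg _) hB0
  have hd_iff : (Summable fun j => a j • d j) ↔ Summable fun n => a n • e n := by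
    constructor
    -- As no `m i` equals any `n j`, the coordinate of the sum at `m j` is `a j`; unconditionality
    -- then gives convergence of `∑ a_j e_{m_j}`.
    · intro hs
      have h1 := (he.summable_coord (∑' j, a j • d j)).comp_injective hmm.injective
      rw [← he.summable_comp_iff a hmm.injective]
      refine h1.congr fun j => ?_
      simp only [Function.comp]
      congr 1
      have h2 := hs.hasSum.mapL (e.coord (m j))
      have h3 : HasSum (fun i => e.coord (m j) (a i • d i)) (a j) := by
        have := hasSum_single (f := fun i => e.coord (m j) (a i • d i)) j (fun i hi => by
          simp [d, e.ortho, hmn j i, hmm.injective.ne hi.symm])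
        simpa [d, e.ortho, hmn j j] using this
      exact h2.unique h3
    · intro hs
      have h1 := (he.summable_comp_iff a hmm.injective).2 hs
      have h2 := (he.summable_comp_iff a hnm.injective).2 hs
      simpa only [d, smul_sub] using h1.sub h2
  rw [← hd_iff, ← summable_smul_iff_of_disjoint hp' hdisj (half_pos hδ) hwl hwu]
  have hbdd : (∃ c > 0, (∀ j, c ≤ ‖d j‖) ∧ ∀ j, c ≤ ‖w j‖) :=
    ⟨δ / 2, half_pos hδ, fun j => by have := hm j; linarith, hwl⟩
  obtain ⟨c, hc, hcd, hcw⟩ := hbdd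
  have hbound : ∀ v : ℕ → lp (fun _ : ℕ => ℂ) p, (∀ j, c ≤ ‖v j‖) →
      (Summable fun j => a j • v j) → ∃ B, ∀ j, ‖a j‖ ≤ B := by
    intro v hv hs
    obtain ⟨B, hB⟩ := isBounded_iff_forall_norm_le.1
      (Metric.isBounded_range_of_tendsto _ hs.tendsto_atTop_zero)
    refine ⟨B / c, fun j => ?_⟩
    rw [le_div_iff₀ hc]
    have := hB _ ⟨j, rfl⟩
    simp only [norm_smul] at this
    exact (mul_le_mul_of_nonneg_left (hv j) (norm_nonneg _)).trans this
  constructor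
  · intro hs
    obtain ⟨B, hB⟩ := hbound d hcd hs
    simpa [smul_sub] using hs.sub (hpert B hB)
  · intro hs
    obtain ⟨B, hB⟩ := hbound w hcw hs
    simpa [smul_sub] using hs.add (hpert B hB)

theorem IsSymmetricBasis.seriesConverges_iff_memℓp (hp' : p ≠ ⊤) (he : IsSymmetricBasis e)
    (a : ℕ → ℂ) : SeriesConverges e a ↔ Memℓp a p := by
  rw [he.seriesConverges_iff_summable, he.summable_iff_memℓp hp']

end Blocks

/-! ### Hardy's inequality. -/

section Hardy

/-- Here `x` and `y` are consecutive averages. Young's inequality for `x ^ (r - 1) * y` turns the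
recursion into a bound whose last bracket telescopes on summation over `N`. -/
theorem hardy_step {r x y a N : ℝ} (hr : 1 < r) (hx : 0 ≤ x) (hy : 0 ≤ y) (ha : 0 ≤ a)
    (hN : 1 ≤ N) (h : N * x = a + (N - 1) * y) :
    (r - 1) / 2 * x ^ r ≤
      r * (2 * r / (r - 1)) ^ (r - 1) * a ^ r + ((N - 1) * y ^ r - N * x ^ r) := by
  have hr1 : 0 < r - 1 := sub_pos.2 hr
  have hr0 : 0 < r := zero_lt_one.trans hr
  have hmul : ∀ z : ℝ, 0 ≤ z → z ^ (r - 1) * z = z ^ r := fun z hz => by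
    conv_lhs => rw [← Real.rpow_one z, ← Real.rpow_mul hz, one_mul,
      ← Real.rpow_add' hz (by simpa using hr0.ne'), sub_add_cancel]
  have hyoung : r * (x ^ (r - 1) * y) ≤ (r - 1) * x ^ r + y ^ r := by
    have hpq : (r / (r - 1)).HolderConjugate r := (Real.HolderConjugate.conjExponent hr).symm
    have := Real.young_inequality_of_nonneg (Real.rpow_nonneg hx (r - 1)) hy hpq
    rw [← Real.rpow_mul hx, mul_div_cancel₀ _ hr1.ne'] at this
    have h2 := mul_le_mul_of_nonneg_left this hr0.le
    have h3 : r * (x ^ r / (r / (r - 1)) + y ^ r / r) = (r - 1) * x ^ r + y ^ r := by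
      field_simp
    rwa [h3] at h2
  have hZ : 0 ≤ x ^ (r - 1) := Real.rpow_nonneg hx _
  have hcore : (r - 1) * x ^ r - r * (x ^ (r - 1) * a) ≤ (N - 1) * y ^ r - N * x ^ r := by
    have ha' : a = N * x - (N - 1) * y := by linarith
    have h1 : x ^ (r - 1) * a = N * x ^ r - (N - 1) * (x ^ (r - 1) * y) := by
      rw [ha', ← hmul x hx]; ring
    have h2 := mul_le_mul_of_nonneg_left hyoung (sub_nonneg.2 hN)
    rw [h1]
    linarith
  -- Either `a` is small relative to `x` and the term is absorbed into half of `(r - 1) * x ^ r`, or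
  -- `x` is at most a constant times `a`.
  have hsplit : r * (x ^ (r - 1) * a) ≤
      (r - 1) / 2 * x ^ r + r * (2 * r / (r - 1)) ^ (r - 1) * a ^ r := by
    rcases le_total (r * a) ((r - 1) / 2 * x) with hle | hle
    · have h1 := mul_le_mul_of_nonneg_left hle hZ
      have h2 : 0 ≤ r * (2 * r / (r - 1)) ^ (r - 1) * a ^ r := by positivity
      calc r * (x ^ (r - 1) * a) = x ^ (r - 1) * (r * a) := by ring
        _ ≤ x ^ (r - 1) * ((r - 1) / 2 * x) := h1
        _ = (r - 1) / 2 * x ^ r := by rw [← hmul x hx]; ring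
        _ ≤ _ := le_add_of_nonneg_right h2
    · have h1 : x ≤ 2 * r / (r - 1) * a := by
        rw [div_mul_eq_mul_div, le_div_iff₀ hr1]; linarith
      have h2 : x ^ (r - 1) ≤ (2 * r / (r - 1)) ^ (r - 1) * a ^ (r - 1) := by
        rw [← Real.mul_rpow (by positivity) ha]
        exact Real.rpow_le_rpow hx h1 hr1.le
      have h3 : 0 ≤ (r - 1) / 2 * x ^ r := by positivity
      calc r * (x ^ (r - 1) * a)
          ≤ r * ((2 * r / (r - 1)) ^ (r - 1) * a ^ (r - 1) * a) := by gcongr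
        _ = r * (2 * r / (r - 1)) ^ (r - 1) * a ^ r := by rw [← hmul a ha]; ring
        _ ≤ _ := le_add_of_nonneg_left h3
  linarith

/-- Hardy's inequality, in qualitative form. -/
theorem summable_rpow_average {r : ℝ} (hr : 1 < r) {a : ℕ → ℝ} (ha : ∀ n, 0 ≤ a n)
    (hs : Summable fun n => a n ^ r) :
    Summable fun n : ℕ => ((∑ i ∈ Finset.range (n + 1), a i) / (n + 1)) ^ r := by
  have hr0 : 0 < r := zero_lt_one.trans hr
  set x : ℕ → ℝ := fun n => (∑ i ∈ Finset.range (n + 1), a i) / (n + 1) with hx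
  have hx0 : ∀ n, 0 ≤ x n := fun n => div_nonneg (Finset.sum_nonneg fun i _ => ha i) (by positivity)
  set C := r * (2 * r / (r - 1)) ^ (r - 1) with hCdef
  have hC : 0 ≤ C := by have := sub_pos.2 hr; positivity
  -- The negative boundary term is what the telescoping leaves; it is kept to run the induction and
  -- dropped at the end.
  have key : ∀ n, (r - 1) / 2 * ∑ i ∈ Finset.range (n + 1), x i ^ r ≤
      C * ∑ i ∈ Finset.range (n + 1), a i ^ r - (n + 1) * x n ^ r := by
    intro n
    induction n with
    | zero =>
      have := hardy_step hr (hx0 0) le_rfl (ha 0) le_rfl (N := 1) (by simp [hx])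
      rw [← hCdef] at this
      simp only [sub_self, zero_mul, one_mul, zero_sub] at this
      simp only [zero_add, Finset.sum_range_one, CharP.cast_eq_zero, one_mul]
      linarith
    | succ n ih =>
      have h1 : ((n : ℝ) + 1 + 1) * x (n + 1) = a (n + 1) + ((n : ℝ) + 1 + 1 - 1) * x n := by
        simp only [hx]
        rw [Finset.sum_range_succ _ (n + 1)]
        push_cast
        field_simp
        ring
      have := hardy_step hr (hx0 (n + 1)) (hx0 n) (ha (n + 1))
        (by have : (0 : ℝ) ≤ n := n.cast_nonneg
            linarith) h1
      rw [← hCdef] at this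
      rw [Finset.sum_range_succ _ (n + 1), Finset.sum_range_succ _ (n + 1), mul_add, mul_add]
      push_cast
      linarith
  have hr1 : 0 < (r - 1) / 2 := by linarith
  refine summable_of_sum_range_le (c := C * (∑' n, a n ^ r) / ((r - 1) / 2))
    (fun n => Real.rpow_nonneg (hx0 n) r) fun n => ?_
  rw [le_div_iff₀ hr1, mul_comm]
  have h1 : ∑ i ∈ Finset.range n, x i ^ r ≤ ∑ i ∈ Finset.range (n + 1), x i ^ r :=
    Finset.sum_le_sum_of_subset_of_nonneg (Finset.range_mono n.le_succ)
      fun i _ _ => Real.rpow_nonneg (hx0 i) r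
  have h2 : C * ∑ i ∈ Finset.range (n + 1), a i ^ r ≤ C * ∑' n, a n ^ r :=
    mul_le_mul_of_nonneg_left
      (hs.sum_le_tsum _ fun i _ => Real.rpow_nonneg (ha i) r) hC
  have h3 : 0 ≤ ((n : ℝ) + 1) * x n ^ r := mul_nonneg (by positivity) (Real.rpow_nonneg (hx0 n) r)
  linarith [key n, mul_le_mul_of_nonneg_left h1 hr1.le]

theorem memℓp_average {p : ℝ≥0∞} (hp : 1 < p) (hp' : p ≠ ⊤) {a : ℕ → ℂ} (ha : Memℓp a p) :
    Memℓp (fun n : ℕ => (∑ i ∈ Finset.range (n + 1), ‖a i‖) / (n + 1)) p := by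
  have hr : 1 < p.toReal := by
    rw [← ENNReal.toReal_one]
    exact (ENNReal.toReal_lt_toReal ENNReal.one_ne_top hp').2 hp
  refine memℓp_gen ?_
  refine (summable_rpow_average hr (fun n => norm_nonneg (a n))
    (ha.summable (zero_lt_one.trans hr))).congr fun n => ?_
  rw [Real.norm_of_nonneg (div_nonneg (Finset.sum_nonneg fun i _ => norm_nonneg _) (by positivity))]

end Hardy

/-! ### Iterated differences and the commutator estimate. -/

section Diff

@[simp]
theorem diff_apply_zero (c : ℕ → ℂ) : diff c 0 = c 0 := by simp [diff]

@[simp]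
theorem diff_apply_succ (c : ℕ → ℂ) (n : ℕ) : diff c (n + 1) = c (n + 1) - c n := rfl

theorem diff_pow_succ_apply (m : ℕ) (c : ℕ → ℂ) : (diff ^ (m + 1)) c = diff ((diff ^ m) c) := by
  rw [pow_succ', Module.End.mul_apply]

theorem norm_le_sum_norm_diff (c : ℕ → ℂ) (n : ℕ) :
    ‖c n‖ ≤ ∑ i ∈ Finset.range (n + 1), ‖diff c i‖ := by
  induction n with
  | zero => simp
  | succ n ih =>
    rw [Finset.sum_range_succ]
    calc ‖c (n + 1)‖ = ‖c n + diff c (n + 1)‖ := by rw [diff_apply_succ, add_sub_cancel]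
      _ ≤ _ := (norm_add_le _ _).trans (add_le_add_left ih _)

/-- Undoing the last difference gives the sum of `|Δ^k c|`; each further summation of at most `n +
1` terms costs a factor `n + 1`. -/
theorem norm_diff_pow_le (c : ℕ → ℂ) (k : ℕ) : ∀ i m, m + i + 1 = k → ∀ n : ℕ,
    ‖(diff ^ m) c n‖ ≤ ((n : ℝ) + 1) ^ i * ∑ l ∈ Finset.range (n + 1), ‖(diff ^ k) c l‖ := by
  intro i
  induction i with
  | zero =>
    rintro m rfl n
    rw [pow_zero, one_mul, add_zero, diff_pow_succ_apply]
    exact norm_le_sum_norm_diff _ n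
  | succ i ih =>
    intro m hm n
    refine (norm_le_sum_norm_diff _ n).trans ?_
    rw [← diff_pow_succ_apply]
    have h1 : ∀ j ∈ Finset.range (n + 1), ‖(diff ^ (m + 1)) c j‖ ≤
        ((n : ℝ) + 1) ^ i * ∑ l ∈ Finset.range (n + 1), ‖(diff ^ k) c l‖ := by
      intro j hj
      have hjn : j ≤ n := Nat.lt_succ_iff.1 (Finset.mem_range.1 hj)
      refine (ih (m + 1) (by omega) j).trans ?_
      gcongr
    refine (Finset.sum_le_sum h1).trans_eq ?_
    rw [Finset.sum_const, Finset.card_range, nsmul_eq_mul]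
    push_cast
    ring

/-- Induction on `m` by the Leibniz rule. The new term pairs the decay of `φ (n + 1) - φ n` with the
growth of `Δ^m c`, and the powers of `n` cancel down to an average. -/
theorem norm_diff_pow_mul_sub_le {k : ℕ} (c φ : ℕ → ℂ) {D : ℝ}
    (hφ : ∀ n : ℕ, ‖φ (n + 1) - φ n‖ ≤ D / ((n : ℝ) + 2) ^ k) :
    ∀ m ≤ k, ∀ n : ℕ, ‖(diff ^ m) (φ * c) n - φ n * (diff ^ m) c n‖ ≤
      4 ^ m * D * ((∑ i ∈ Finset.range (n + 1), ‖(diff ^ k) c i‖) / (n + 1)) := by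
  have hD : 0 ≤ D := by
    have h0 := (norm_nonneg _).trans (hφ 0)
    by_contra hneg
    exact absurd h0 (not_le.2 (div_neg_of_neg_of_pos (not_le.1 hneg) (by positivity)))
  set A : ℕ → ℝ := fun n => ∑ i ∈ Finset.range (n + 1), ‖(diff ^ k) c i‖ with hA
  have hA0 : ∀ n, 0 ≤ A n := fun n => Finset.sum_nonneg fun i _ => norm_nonneg _
  have hAm : ∀ n, A n ≤ A (n + 1) := fun n => by
    simp only [hA]
    rw [Finset.sum_range_succ _ (n + 1)]
    exact le_add_of_nonneg_right (norm_nonneg _)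
  intro m
  induction m with
  | zero =>
    intro _ n
    have := hA0 n
    simp only [pow_zero, Module.End.one_apply, Pi.mul_apply, sub_self, norm_zero, one_mul]
    positivity
  | succ m ih =>
    intro hm n
    have ih := ih (by omega)
    rw [diff_pow_succ_apply, diff_pow_succ_apply]
    cases n with
    | zero =>
      rw [diff_apply_zero, diff_apply_zero]
      refine (ih 0).trans ?_
      have := hA0 0
      gcongr
      · norm_num
      · omega
    | succ n =>
      have hn0 : (0 : ℝ) < (n : ℝ) + 1 := by positivity
      have hn2 : (0 : ℝ) < (n : ℝ) + 2 := by positivity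
      have e1 : diff ((diff ^ m) (φ * c)) (n + 1) - φ (n + 1) * diff ((diff ^ m) c) (n + 1) =
          ((diff ^ m) (φ * c) (n + 1) - φ (n + 1) * (diff ^ m) c (n + 1))
          - ((diff ^ m) (φ * c) n - φ n * (diff ^ m) c n)
          + (φ (n + 1) - φ n) * (diff ^ m) c n := by
        rw [diff_apply_succ, diff_apply_succ]; ring
      have b1 := ih (n + 1)
      -- The factor 2 pays for replacing `n + 1` by `n + 2` in the denominator. The three
      -- contributions `4 ^ m`, `2 * 4 ^ m` and 1 then fit into `4 ^ (m + 1)`.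
      have b2 : ‖(diff ^ m) (φ * c) n - φ n * (diff ^ m) c n‖ ≤
          4 ^ m * D * (2 * (A (n + 1) / ((n : ℝ) + 2))) := by
        refine (ih n).trans ?_
        refine mul_le_mul_of_nonneg_left ?_ (by positivity)
        rw [mul_div_assoc', div_le_div_iff₀ hn0 hn2]
        nlinarith [hAm n, hA0 n, (n.cast_nonneg : (0 : ℝ) ≤ n)]
      have b3 : ‖(φ (n + 1) - φ n) * (diff ^ m) c n‖ ≤ D * (A (n + 1) / ((n : ℝ) + 2)) := by
        rw [norm_mul]
        obtain ⟨i, rfl⟩ : ∃ i, k = m + i + 1 := ⟨k - m - 1, by omega⟩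
        have h1 := norm_diff_pow_le c (m + i + 1) i m rfl n
        have h2 : ((n : ℝ) + 1) ^ i ≤ ((n : ℝ) + 2) ^ (m + i) := by
          calc ((n : ℝ) + 1) ^ i ≤ ((n : ℝ) + 2) ^ i := by gcongr; norm_num
            _ ≤ _ := pow_le_pow_right₀ (by linarith) (by omega)
        calc _ ≤ D / ((n : ℝ) + 2) ^ (m + i + 1) * (((n : ℝ) + 1) ^ i * A n) :=
              mul_le_mul (hφ n) h1 (norm_nonneg _) (by positivity)
          _ ≤ D / ((n : ℝ) + 2) ^ (m + i + 1) * (((n : ℝ) + 2) ^ (m + i) * A (n + 1)) := by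
              have := hA0 n
              have := hAm n
              gcongr
          _ = _ := by rw [pow_succ]; field_simp
      have hpos : 0 ≤ A (n + 1) / ((n : ℝ) + 2) := div_nonneg (hA0 _) hn2.le
      have e2 : ((n + 1 : ℕ) : ℝ) + 1 = (n : ℝ) + 2 := by push_cast; ring
      rw [e1]
      rw [e2] at b1 ⊢
      have h4 : (1 : ℝ) ≤ 4 ^ m := one_le_pow₀ (by norm_num)
      have h5 := mul_le_mul_of_nonneg_right h4 (mul_nonneg hD hpos)
      refine (norm_add_le _ _).trans ((add_le_add (norm_sub_le _ _) le_rfl).trans ?_)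
      have h6 : (4 : ℝ) ^ (m + 1) * D * (A (n + 1) / ((n : ℝ) + 2)) =
        4 * (4 ^ m * (D * (A (n + 1) / ((n : ℝ) + 2)))) := by ring
      rw [h6]
      linarith

theorem diff_surjective : Function.Surjective diff := by
  intro a
  refine ⟨fun n => ∑ i ∈ Finset.range (n + 1), a i, ?_⟩
  funext n
  cases n with
  | zero => simp
  | succ n => rw [diff_apply_succ, Finset.sum_range_succ _ (n + 1), add_sub_cancel_left]

theorem diff_pow_surjective (k : ℕ) : Function.Surjective (diff ^ k) := by
  rw [Module.End.coe_pow]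
  exact diff_surjective.iterate k

theorem continuous_diff_pow {X : Type*} [TopologicalSpace X] {c : X → ℕ → ℂ}
    (hc : ∀ n, Continuous fun x => c x n) (k : ℕ) :
    ∀ n, Continuous fun x => (diff ^ k) (c x) n := by
  induction k with
  | zero => exact hc
  | succ k ih =>
    intro n
    simp only [diff_pow_succ_apply]
    cases n with
    | zero => simpa using ih 0
    | succ n => simpa using (ih (n + 1)).fun_sub (ih n)

theorem continuous_of_continuous_diff_pow {X : Type*} [TopologicalSpace X] {c : X → ℕ → ℂ} (k : ℕ)
    (hc : ∀ n, Continuous fun x => (diff ^ k) (c x) n) : ∀ n, Continuous fun x => c x n := by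
  induction k with
  | zero => exact hc
  | succ k ih =>
    refine ih fun n => ?_
    simp only [diff_pow_succ_apply] at hc
    induction n with
    | zero => simpa using hc 0
    | succ n ih' => simpa using (hc (n + 1)).fun_add ih'

variable {p : ℝ≥0∞}

theorem memℓp_shift (hp : 0 < p.toReal) {c : ℕ → ℂ} (hc : Memℓp c p) :
    Memℓp (c - diff c) p := by
  rw [memℓp_gen_iff hp] at hc ⊢
  rw [← summable_nat_add_iff 1]
  refine hc.congr fun n => ?_
  simp

theorem memℓp_diff_pow (hp : 0 < p.toReal) {c : ℕ → ℂ} (hc : Memℓp c p) (k : ℕ) :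
    Memℓp ((diff ^ k) c) p := by
  induction k with
  | zero => exact hc
  | succ k ih =>
    rw [diff_pow_succ_apply]
    simpa using ih.sub (memℓp_shift hp ih)

theorem memℓp_of_finite_support (hp : 0 < p.toReal) {c : ℕ → ℂ} {N : ℕ} (h : ∀ n, N ≤ n → c n = 0) :
    Memℓp c p := by
  refine memℓp_gen (summable_of_ne_finset_zero (s := Finset.range N) fun n hn => ?_)
  rw [h n (by simpa using hn), norm_zero, Real.zero_rpow hp.ne']

theorem tendsto_lp_of_dominated [Fact (1 ≤ p)] (hp' : p ≠ ⊤) {ι : Type*} {l : Filter ι}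
    {F : ι → lp (fun _ : ℕ => ℂ) p} {g : ℕ → ℝ} (hg : Memℓp g p)
    (hlim : ∀ n, Tendsto (fun i => F i n) l (𝓝 0)) (hb : ∀ᶠ i in l, ∀ n, ‖F i n‖ ≤ g n) :
    Tendsto F l (𝓝 0) := by
  have hp0 := toReal_pos_of_ne_top hp'
  have h1 := tendsto_tsum_of_dominated_convergence (𝓕 := l)
    (f := fun i n => ‖F i n‖ ^ p.toReal) (g := fun _ => (0 : ℝ)) (hg.summable hp0)
    (fun n => by
      have := ((hlim n).norm).rpow_const (p := p.toReal) (Or.inr hp0.le)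
      simpa [Real.zero_rpow hp0.ne'] using this)
    (hb.mono fun i hi n => by
      rw [Real.norm_of_nonneg (by positivity)]
      exact Real.rpow_le_rpow (norm_nonneg _) ((hi n).trans (Real.le_norm_self _)) hp0.le)
  have h2 := h1.rpow_const (p := 1 / p.toReal) (Or.inr (by positivity))
  rw [tsum_zero, Real.zero_rpow (one_div_ne_zero hp0.ne')] at h2
  rw [tendsto_zero_iff_norm_tendsto_zero]
  simpa only [lp.norm_eq_tsum_rpow hp0] using h2

end Diff

/-! ### The closed graph theorem and the Banach space of formal series. -/

theorem continuous_of_separating {X F : Type*} [NormedAddCommGroup X] [NormedSpace ℂ X]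
    [CompleteSpace X] [NormedAddCommGroup F] [NormedSpace ℂ F] [CompleteSpace F] (g : X →ₗ[ℂ] F)
    {ev : ℕ → F → ℂ} (hev : ∀ n, Continuous (ev n))
    (hsep : ∀ y z, (∀ n, ev n y = ev n z) → y = z) (hg : ∀ n, Continuous fun x => ev n (g x)) :
    Continuous g := by
  refine g.continuous_of_seq_closed_graph fun u x y hu hgu => hsep _ _ fun n => ?_
  exact tendsto_nhds_unique (((hev n).tendsto y).comp hgu) (((hg n).tendsto x).comp hu)

section General

variable {E : Type*} [NormedAddCommGroup E]

theorem tendsto_zero_of_hasSum_conditional {u : ℕ → E} {x : E}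
    (h : HasSum u x (SummationFilter.conditional ℕ)) : Tendsto u atTop (𝓝 0) := by
  obtain ⟨y, hy⟩ := summable_conditional_iff.1 h.summable
  have := ((tendsto_add_atTop_iff_nat 1).2 hy).sub hy
  simpa [Finset.sum_range_succ] using this

variable [NormedSpace ℂ E] {e : SchauderBasis ℂ E} {k : ℕ}

theorem coord_toSum (x : FormalSpace e k) (n : ℕ) :
    e.coord n (FormalSpace.toSum x) = (diff ^ k) (FormalSpace.coeff x) n :=
  coord_eq_of_hasSum e (FormalSpace.hasSum_toSum x) n

theorem FormalSpace.ext_coeff {x y : FormalSpace e k}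
    (h : ∀ n, FormalSpace.coeff x n = FormalSpace.coeff y n) : x = y :=
  Subtype.ext (funext h)

@[simp]
theorem FormalSpace.coeff_mk (c : ℕ → ℂ) (hc : c ∈ formalSubmodule e k) :
    FormalSpace.coeff (FormalSpace.mk c hc) = c := rfl

theorem toSum_surjective : Function.Surjective (FormalSpace.toSum : FormalSpace e k →ₗ[ℂ] E) := by
  intro y
  obtain ⟨c, hc⟩ := diff_pow_surjective k fun n => e.coord n y
  have hmem : c ∈ formalSubmodule e k := by
    change SeriesConverges e ((diff ^ k) c)
    rw [hc]
    exact (e.expansion y).summable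
  refine ⟨FormalSpace.mk c hmem, ext_coord e fun n => ?_⟩
  rw [coord_toSum, FormalSpace.coeff_mk, hc]

/-- The space of formal series is isometric to the underlying Banach space. -/
noncomputable def toSumEquiv : FormalSpace e k ≃ₗᵢ[ℂ] E :=
  LinearIsometryEquiv.ofSurjective ⟨FormalSpace.toSum, fun _ => rfl⟩ toSum_surjective

theorem toSumEquiv_apply (x : FormalSpace e k) : toSumEquiv x = FormalSpace.toSum x := rfl

instance [CompleteSpace E] : CompleteSpace (FormalSpace e k) :=
  (completeSpace_congr (e := (toSumEquiv (e := e) (k := k)).toEquiv)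
    toSumEquiv.isometry.isUniformEmbedding).2 inferInstance

/-- Each `c_n` is a finite combination of entries of `Δ^k c`, which are basis coordinates of the sum
in `E`. -/
theorem continuous_coeff (n : ℕ) : Continuous fun x : FormalSpace e k => FormalSpace.coeff x n := by
  refine continuous_of_continuous_diff_pow k (c := fun x : FormalSpace e k => FormalSpace.coeff x)
    (fun m => ?_) n
  simp only [← coord_toSum]
  exact (e.coord m).continuous.comp toSumEquiv.continuous

/-- The coefficient functionals on the space of formal series. -/
noncomputable def coeffCLM (n : ℕ) : FormalSpace e k →L[ℂ] ℂ where
  toFun x := FormalSpace.coeff x n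
  map_add' _ _ := rfl
  map_smul' _ _ := rfl
  cont := continuous_coeff n

@[simp]
theorem coeffCLM_apply (n : ℕ) (x : FormalSpace e k) : coeffCLM n x = FormalSpace.coeff x n := rfl

/-- Coefficientwise multiplication by a sequence that preserves the space of formal series. -/
noncomputable def mulLinear (φ : ℕ → ℂ)
    (hφ : ∀ c ∈ formalSubmodule e k, φ * c ∈ formalSubmodule e k) :
    FormalSpace e k →ₗ[ℂ] FormalSpace e k where
  toFun x := FormalSpace.mk (φ * FormalSpace.coeff x) (hφ _ x.2)
  map_add' x y := FormalSpace.ext_coeff fun n => by simp [mul_add]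
  map_smul' a x := FormalSpace.ext_coeff fun n => by simp

theorem coeff_mulLinear (φ : ℕ → ℂ)
    (hφ : ∀ c ∈ formalSubmodule e k, φ * c ∈ formalSubmodule e k) (x : FormalSpace e k) (n : ℕ) :
    FormalSpace.coeff (mulLinear φ hφ x) n = φ n * FormalSpace.coeff x n := rfl

/-- Coefficientwise multiplication is bounded, by the closed graph theorem. -/
noncomputable def mulCLM [CompleteSpace E] (φ : ℕ → ℂ)
    (hφ : ∀ c ∈ formalSubmodule e k, φ * c ∈ formalSubmodule e k) :
    FormalSpace e k →L[ℂ] FormalSpace e k where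
  toLinearMap := mulLinear φ hφ
  cont := continuous_of_separating (mulLinear φ hφ)
    (ev := fun n x => FormalSpace.coeff x n) continuous_coeff
    (fun _ _ => FormalSpace.ext_coeff) fun n => by
      simp only [coeff_mulLinear]
      exact continuous_const.mul (continuous_coeff n)

end General

/-! ### Formal series over a symmetric basis of `ℓ_p`; failure of the basis property. -/

theorem diff_pow_single (k n : ℕ) :
    (∀ m < n, (diff ^ k) (Pi.single n 1) m = 0) ∧ (diff ^ k) (Pi.single n 1) n = 1 := by
  induction k with
  | zero =>
    simp only [pow_zero, Module.End.one_apply]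
    exact ⟨fun m hm => Pi.single_eq_of_ne hm.ne _, Pi.single_eq_same _ _⟩
  | succ k ih =>
    rw [diff_pow_succ_apply]
    constructor
    · intro m hm
      cases m with
      | zero => rw [diff_apply_zero, ih.1 0 hm]
      | succ m => rw [diff_apply_succ, ih.1 _ hm, ih.1 m (by omega), sub_zero]
    · cases n with
      | zero => rw [diff_apply_zero, ih.2]
      | succ n => rw [diff_apply_succ, ih.2, ih.1 n n.lt_succ_self, sub_zero]

theorem diff_one : diff 1 = Pi.single 0 1 := by
  funext n
  cases n with
  | zero => simp
  | succ n => simp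

section Lp

variable {p : ℝ≥0∞} [Fact (1 ≤ p)] {e : SchauderBasis ℂ (lp (fun _ : ℕ => ℂ) p)} {k : ℕ}

theorem continuous_lp_of_continuous_apply {X : Type*} [NormedAddCommGroup X] [NormedSpace ℂ X]
    [CompleteSpace X] (g : X →ₗ[ℂ] lp (fun _ : ℕ => ℂ) p)
    (hg : ∀ n, Continuous fun x => g x n) : Continuous g :=
  continuous_of_separating g (ev := fun n y => y n)
    (fun n => (lp.evalCLM ℂ (fun _ : ℕ => ℂ) p n).continuous)
    (fun _ _ h => lp.ext (funext h)) hg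

/-- Expansion in a symmetric basis of `ℓ_p` identifies `ℓ_p` with the coefficient space `ℓ_p`. -/
theorem IsSymmetricBasis.exists_coordEquiv (hp' : p ≠ ⊤) (he : IsSymmetricBasis e) :
    ∃ Φ : lp (fun _ : ℕ => ℂ) p ≃L[ℂ] lp (fun _ : ℕ => ℂ) p, ∀ x n, Φ x n = e.coord n x := by
  let g : lp (fun _ : ℕ => ℂ) p →ₗ[ℂ] lp (fun _ : ℕ => ℂ) p :=
    { toFun := fun x => ⟨fun n => e.coord n x,
        (he.seriesConverges_iff_memℓp hp' _).1 (e.expansion x).summable⟩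
      map_add' := fun x y => lp.ext (funext fun n => map_add (e.coord n) x y)
      map_smul' := fun a x => lp.ext (funext fun n => map_smul (e.coord n) a x) }
  have hg : ∀ x n, g x n = e.coord n x := fun _ _ => rfl
  have hc : Continuous g := continuous_lp_of_continuous_apply g fun n => (e.coord n).continuous
  have hbij : Function.Bijective g := by
    refine ⟨fun x y hxy => ext_coord e fun n => ?_, fun a => ?_⟩
    · rw [← hg, ← hg, hxy]
    · obtain ⟨x, hx⟩ := (he.seriesConverges_iff_memℓp hp' _).2 (lp.memℓp a)
      exact ⟨x, lp.ext (funext fun n => coord_eq_of_hasSum e hx n)⟩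
  exact ⟨(LinearEquiv.ofBijective g hbij).toContinuousLinearEquivOfContinuous hc, fun x n => rfl⟩

theorem IsSymmetricBasis.mem_formalSubmodule_iff (hp' : p ≠ ⊤) (he : IsSymmetricBasis e)
    (c : ℕ → ℂ) : c ∈ formalSubmodule e k ↔ Memℓp ((diff ^ k) c) p :=
  he.seriesConverges_iff_memℓp hp' _

theorem IsSymmetricBasis.exists_formalEquiv (hp' : p ≠ ⊤) (he : IsSymmetricBasis e) :
    ∃ V : FormalSpace e k ≃L[ℂ] lp (fun _ : ℕ => ℂ) p,
      ∀ x n, V x n = (diff ^ k) (FormalSpace.coeff x) n := by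
  obtain ⟨Φ, hΦ⟩ := he.exists_coordEquiv hp'
  refine ⟨toSumEquiv.toContinuousLinearEquiv.trans Φ, fun x n => ?_⟩
  rw [← coord_toSum, ← hΦ]
  rfl

theorem IsSymmetricBasis.exists_units_not_basis (hp' : p ≠ ⊤) (he : IsSymmetricBasis e)
    (hk : 1 ≤ k) : ∃ v : ℕ → FormalSpace e k,
      (∀ n, FormalSpace.coeff (v n) = Pi.single n 1) ∧
      ¬ ∃ b : SchauderBasis ℂ (FormalSpace e k), ∀ n, b n = v n := by
  have hp0 := toReal_pos_of_ne_top hp'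
  have hsingle : ∀ n, Memℓp (Pi.single n 1 : ℕ → ℂ) p := fun n =>
    memℓp_of_finite_support hp0 (N := n + 1) fun m hm => Pi.single_eq_of_ne (by omega) _
  obtain ⟨V, hV⟩ := he.exists_formalEquiv (k := k) hp'
  refine ⟨fun n => FormalSpace.mk (Pi.single n 1)
    ((he.mem_formalSubmodule_iff hp' _).2 (memℓp_diff_pow hp0 (hsingle n) k)), fun n => rfl, ?_⟩
  rintro ⟨b, hb⟩
  -- Since `Δ1` is the first unit vector and `k ≥ 1`, the sequence `Δ^k 1` has only finitely many
  -- differences left to take and stays in `ℓ_p`.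
  have hone : (1 : ℕ → ℂ) ∈ formalSubmodule e k := by
    obtain ⟨j, rfl⟩ : ∃ j, k = j + 1 := ⟨k - 1, by omega⟩
    rw [he.mem_formalSubmodule_iff hp', pow_succ, Module.End.mul_apply, diff_one]
    exact memℓp_diff_pow hp0 (hsingle 0) j
  set x : FormalSpace e k := FormalSpace.mk 1 hone with hx
  have hcoord : ∀ m, b.coord m x = 1 := by
    intro m
    have h1 := (b.expansion x).mapL (coeffCLM m)
    have hbc : ∀ n, FormalSpace.coeff (b n) = Pi.single n 1 := fun n => by rw [hb]; rfl
    have h2 : HasSum (fun n => coeffCLM m (b.coord n x • b n)) (b.coord m x)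
        (SummationFilter.conditional ℕ) := by
      have := hasSum_single (L := SummationFilter.conditional ℕ)
        (f := fun n => coeffCLM m (b.coord n x • b n)) m (fun n hn => by
          simp [hbc, hn.symm])
      simpa [hbc] using this
    exact h2.unique h1
  -- All coefficients being 1, convergence forces `b n → 0`; yet `Δ^k` of the `n`-th unit vector has
  -- entry 1 at `n`.
  have h0 := tendsto_zero_of_hasSum_conditional (b.expansion x)
  simp only [hcoord, one_smul] at h0
  have h1 := ((V.continuous.tendsto 0).comp h0).norm
  rw [map_zero, norm_zero] at h1
  obtain ⟨n, hn⟩ := (h1.eventually (gt_mem_nhds one_pos)).exists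
  have h2 := lp.norm_apply_le_norm (zero_lt_one.trans_le (Fact.out : 1 ≤ p)).ne' (V (b n)) n
  rw [hV, hb] at h2
  have h3 := (diff_pow_single k n).2
  rw [FormalSpace.coeff_mk, h3, norm_one, ← hb] at h2
  exact absurd hn (not_lt.2 h2)

end Lp

/-! ### Density of the range of `(I - T)^k` and the completion. -/

section Shift

variable {p : ℝ≥0∞} [Fact (1 ≤ p)]

theorem exists_oneSubShift (hp' : p ≠ ⊤) :
    ∃ R : lp (fun _ : ℕ => ℂ) p →L[ℂ] lp (fun _ : ℕ => ℂ) p, ∀ x, (R x : ℕ → ℂ) = diff x := by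
  have hp0 := toReal_pos_of_ne_top hp'
  let g : lp (fun _ : ℕ => ℂ) p →ₗ[ℂ] lp (fun _ : ℕ => ℂ) p :=
    { toFun := fun x => ⟨diff x, show Memℓp (diff x) p by
        simpa using memℓp_diff_pow hp0 (lp.memℓp x) 1⟩
      map_add' := fun x y => lp.ext (map_add diff (x : ℕ → ℂ) y)
      map_smul' := fun a x => lp.ext (map_smul diff a (x : ℕ → ℂ)) }
  have hg : ∀ x, (g x : ℕ → ℂ) = diff x := fun _ => rfl
  refine ⟨⟨g, continuous_lp_of_continuous_apply g fun n => ?_⟩, hg⟩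
  have := continuous_diff_pow (c := fun x : lp (fun _ : ℕ => ℂ) p => (x : ℕ → ℂ))
    (fun n => (lp.evalCLM ℂ (fun _ : ℕ => ℂ) p n).continuous) 1 n
  rw [pow_one] at this
  exact this

/-- The norm is `(N + 1) ^ (1/p - 1)`, which tends to zero because `p > 1`. -/
theorem tendsto_average_single (hp : 1 < p) (hp' : p ≠ ⊤) (m : ℕ) :
    Tendsto (fun N : ℕ => ((N : ℂ) + 1)⁻¹ •
      ∑ i ∈ Finset.range (N + 1), (lp.single p (m + i) (1 : ℂ) : lp (fun _ : ℕ => ℂ) p))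
      atTop (𝓝 0) := by
  have hp0 := toReal_pos_of_ne_top hp'
  have hr : 1 < p.toReal := by
    rw [← ENNReal.toReal_one]
    exact (ENNReal.toReal_lt_toReal ENNReal.one_ne_top hp').2 hp
  have hnorm : ∀ N : ℕ,
      ‖∑ i ∈ Finset.range (N + 1), (lp.single p (m + i) (1 : ℂ) : lp (fun _ : ℕ => ℂ) p)‖ =
        ((N : ℝ) + 1) ^ (p.toReal)⁻¹ := by
    intro N
    have h1 := lp.norm_sum_single (E := fun _ : ℕ => ℂ) hp0 (fun _ => (1 : ℂ))
      (Finset.Ico m (m + (N + 1)))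
    rw [Finset.sum_Ico_eq_sum_range, add_tsub_cancel_left] at h1
    simp only [norm_one, Real.one_rpow, Finset.sum_const, Nat.card_Ico, add_tsub_cancel_left,
      nsmul_eq_mul, mul_one, Nat.cast_add, Nat.cast_one] at h1
    rw [← h1, ← Real.rpow_mul (norm_nonneg _), mul_inv_cancel₀ hp0.ne', Real.rpow_one]
  rw [tendsto_zero_iff_norm_tendsto_zero]
  have hexp : 0 < 1 - (p.toReal)⁻¹ := sub_pos.2 (inv_lt_one_of_one_lt₀ hr)
  have h2 := (tendsto_rpow_neg_atTop hexp).comp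
    (tendsto_atTop_add_const_right atTop (1 : ℝ) tendsto_natCast_atTop_atTop)
  refine h2.congr fun N => ?_
  have hN : (0 : ℝ) < (N : ℝ) + 1 := by positivity
  have hc : ‖((N : ℂ) + 1)⁻¹‖ = ((N : ℝ) + 1)⁻¹ := by
    rw [norm_inv, ← Nat.cast_add_one, Complex.norm_natCast, Nat.cast_add_one]
  rw [norm_smul, hnorm, hc, Function.comp, neg_sub, Real.rpow_sub hN, Real.rpow_one,
    div_eq_inv_mul]

/-- The range contains every difference of unit vectors `δ_m - δ_{m+i}`. Averaging over `i`
approximates `δ_m`, and the unit vectors span a dense subspace. -/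
theorem denseRange_oneSubShift (hp : 1 < p) (hp' : p ≠ ⊤)
    {R : lp (fun _ : ℕ => ℂ) p →L[ℂ] lp (fun _ : ℕ => ℂ) p} (hR : ∀ x, (R x : ℕ → ℂ) = diff x) :
    DenseRange R := by
  let M : Submodule ℂ (lp (fun _ : ℕ => ℂ) p) := LinearMap.range R.toLinearMap
  have hMc : ∀ x, x ∈ M.topologicalClosure ↔ x ∈ closure (Set.range R) := fun x => Iff.rfl
  have hstep : ∀ n, R (lp.single p n (1 : ℂ)) = lp.single p n (1 : ℂ) - lp.single p (n + 1) (1 : ℂ) := by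
    intro n
    refine lp.ext ?_
    rw [hR]
    funext i
    rw [lp.coeFn_sub, Pi.sub_apply]
    cases i with
    | zero => simp [lp.single_apply]
    | succ i => simp [lp.single_apply, Pi.single_apply]
  have hdiff : ∀ m i, (lp.single p m (1 : ℂ) - lp.single p (m + i) (1 : ℂ) :
      lp (fun _ : ℕ => ℂ) p) ∈ M := by
    intro m i
    induction i with
    | zero => simp
    | succ i ih =>
      have := M.add_mem ih ⟨lp.single p (m + i) (1 : ℂ), hstep (m + i)⟩
      rwa [sub_add_sub_cancel] at this
  have hsingle : ∀ m, (lp.single p m (1 : ℂ) : lp (fun _ : ℕ => ℂ) p) ∈ M.topologicalClosure := by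
    intro m
    have h1 := (tendsto_average_single hp hp' m).const_sub
      (lp.single p m (1 : ℂ) : lp (fun _ : ℕ => ℂ) p)
    rw [sub_zero] at h1
    refine mem_closure_of_tendsto h1 (Eventually.of_forall fun N => ?_)
    have h2 : ((N : ℂ) + 1)⁻¹ • ∑ i ∈ Finset.range (N + 1),
        (lp.single p m (1 : ℂ) - lp.single p (m + i) (1 : ℂ) : lp (fun _ : ℕ => ℂ) p) ∈ M :=
      M.smul_mem _ (M.sum_mem fun i _ => hdiff m i)
    rw [Finset.sum_sub_distrib, smul_sub, Finset.sum_const, Finset.card_range,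
      ← Nat.cast_smul_eq_nsmul ℂ, smul_smul, Nat.cast_add_one,
      inv_mul_cancel₀ (Nat.cast_add_one_ne_zero N), one_smul] at h2
    exact h2
  intro x
  rw [← hMc]
  refine M.isClosed_topologicalClosure.mem_of_tendsto (tendsto_restrict_range hp' x)
    (Eventually.of_forall fun N => ?_)
  refine Submodule.sum_mem _ fun i _ => ?_
  have : (lp.single p i (x i) : lp (fun _ : ℕ => ℂ) p) = x i • lp.single p i (1 : ℂ) := by
    rw [← lp.single_smul, smul_eq_mul, mul_one]
  rw [this]
  exact Submodule.smul_mem _ _ (hsingle i)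

theorem denseRange_pow {E : Type*} [NormedAddCommGroup E] [NormedSpace ℂ E] {R : E →L[ℂ] E}
    (hR : DenseRange R) (k : ℕ) : DenseRange (R ^ k) := by
  induction k with
  | zero => exact Function.surjective_id.denseRange
  | succ k ih => rw [pow_succ]; exact ih.comp hR (R ^ k).continuous

theorem IsSymmetricBasis.exists_completion {e : SchauderBasis ℂ (lp (fun _ : ℕ => ℂ) p)}
    (hp : 1 < p) (hp' : p ≠ ⊤) (he : IsSymmetricBasis e) (k : ℕ) :
    ∃ T : lp (fun _ : ℕ => ℂ) p →L[ℂ] lp (fun _ : ℕ => ℂ) p,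
      (∀ n, T (e n) = e (n + 1)) ∧
      ∃ ι : lp (fun _ : ℕ => ℂ) p →ₗ[ℂ] FormalSpace e k,
        (∀ x n, FormalSpace.coeff (ι x) n = e.coord n x) ∧
        (∀ x, ‖ι x‖ = ‖((1 - T) ^ k) x‖) ∧
        DenseRange ι := by
  have hp0 := toReal_pos_of_ne_top hp'
  obtain ⟨Φ, hΦ⟩ := he.exists_coordEquiv hp'
  obtain ⟨R, hR⟩ := exists_oneSubShift (p := p) hp'
  -- `Q` is `I - T` read in the coordinates of `e`; the embedding `ι` followed by the isometry
  -- `toSumEquiv` is `Q ^ k`.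
  let Q : lp (fun _ : ℕ => ℂ) p →L[ℂ] lp (fun _ : ℕ => ℂ) p :=
    (Φ.symm : lp (fun _ : ℕ => ℂ) p →L[ℂ] lp (fun _ : ℕ => ℂ) p) ∘L R ∘L
      (Φ : lp (fun _ : ℕ => ℂ) p →L[ℂ] lp (fun _ : ℕ => ℂ) p)
  have hQ : ∀ x, (fun n => e.coord n (Q x)) = diff fun n => e.coord n x := by
    intro x
    have h1 : ∀ y, (fun n => e.coord n y) = (Φ y : ℕ → ℂ) := fun y => funext fun n => (hΦ y n).symm
    rw [h1, h1, ← hR]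
    simp [Q]
  have hQk : ∀ x, (fun n => e.coord n ((Q ^ k) x)) = (diff ^ k) fun n => e.coord n x := by
    intro x
    induction k with
    | zero => rfl
    | succ k ih =>
      rw [diff_pow_succ_apply, ← ih, ← hQ, pow_succ']
      rfl
  have hQd : DenseRange Q :=
    Φ.symm.surjective.denseRange.comp
      ((denseRange_oneSubShift hp hp' hR).comp Φ.surjective.denseRange R.continuous)
      Φ.symm.continuous
  let ι : lp (fun _ : ℕ => ℂ) p →ₗ[ℂ] FormalSpace e k :=
    { toFun := fun x => FormalSpace.mk (fun n => e.coord n x)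
        ((he.mem_formalSubmodule_iff hp' _).2 (memℓp_diff_pow hp0
          ((he.seriesConverges_iff_memℓp hp' _).1 (e.expansion x).summable) k))
      map_add' := fun x y => FormalSpace.ext_coeff fun n => map_add (e.coord n) x y
      map_smul' := fun a x => FormalSpace.ext_coeff fun n => map_smul (e.coord n) a x }
  have hι : ∀ x, toSumEquiv (ι x) = (Q ^ k) x := fun x => ext_coord e fun n => by
    rw [toSumEquiv_apply, coord_toSum]
    exact (congrFun (hQk x) n).symm
  refine ⟨1 - Q, fun n => ext_coord e fun m => ?_, ι, fun x n => rfl, fun x => ?_, ?_⟩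
  · have h1 := congrFun (hQ (e n)) m
    have h2 : e.coord m ((1 - Q) (e n)) = e.coord m (e n) - e.coord m (Q (e n)) := by
      simp
    rw [h2, h1]
    cases m with
    | zero => simp [e.ortho]
    | succ m => simp [e.ortho, Pi.single_apply]
  · rw [sub_sub_cancel, ← hι, LinearIsometryEquiv.norm_map]
  · have h1 : (ι : lp (fun _ : ℕ => ℂ) p → FormalSpace e k) = toSumEquiv.symm ∘ (Q ^ k) := by
      funext x
      rw [Function.comp_apply, ← hι, LinearIsometryEquiv.symm_apply_apply]
    rw [h1]
    exact toSumEquiv.symm.surjective.denseRange.comp (denseRange_pow hQd k)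
      toSumEquiv.symm.continuous

end Shift

/-! ### The multipliers `exp (i t f(n))`. -/

section Phase

/-- The eigenvalues `exp (i t f(n))` of the group generated by the diagonal operator. -/
noncomputable def phase (f : ℝ → ℝ) (t : ℝ) (n : ℕ) : ℂ :=
  Complex.exp (Complex.I * ((t * f (n + 1) : ℝ) : ℂ))

theorem phase_zero (f : ℝ → ℝ) (n : ℕ) : phase f 0 n = 1 := by simp [phase]

theorem phase_add (f : ℝ → ℝ) (s t : ℝ) (n : ℕ) : phase f (s + t) n = phase f s n * phase f t n := by
  rw [phase, phase, phase, ← Complex.exp_add]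
  congr 1
  push_cast
  ring

theorem norm_phase (f : ℝ → ℝ) (t : ℝ) (n : ℕ) : ‖phase f t n‖ = 1 := by
  rw [phase, mul_comm, Complex.norm_exp_ofReal_mul_I]

theorem hasDerivAt_phase (f : ℝ → ℝ) (t : ℝ) (n : ℕ) :
    HasDerivAt (fun t => phase f t n) (phase f t n * (Complex.I * (f (n + 1) : ℂ))) t := by
  have h1 : HasDerivAt (fun t : ℝ => ((t * f (n + 1) : ℝ) : ℂ)) ((f (n + 1) : ℝ) : ℂ) t := by
    simpa using ((hasDerivAt_id t).mul_const (f (n + 1))).ofReal_comp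
  exact (h1.const_mul Complex.I).cexp

theorem continuous_phase (f : ℝ → ℝ) (n : ℕ) : Continuous fun t => phase f t n :=
  continuous_iff_continuousAt.2 fun t => (hasDerivAt_phase f t n).continuousAt

/-- This follows from `|exp (i s) - 1| ≤ |s|`. The denominator is `n + 2` because Lean index `n + 1`
is mathematical index `n + 2`. -/
theorem norm_phase_succ_sub_le {k : ℕ} (hk : 1 ≤ k) {f : ℝ → ℝ} (hf : BoundedDiffs k f) :
    ∃ C : ℝ, ∀ (t : ℝ) (n : ℕ),
      ‖phase f t (n + 1) - phase f t n‖ ≤ |t| * C / ((n : ℝ) + 2) ^ k := by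
  obtain ⟨C, hC⟩ := hf 1 le_rfl hk
  refine ⟨C, fun t n => ?_⟩
  have h1 := hC (n + 2) (by omega)
  have e1 : ((n + 2 : ℕ) : ℝ) - (1 : ℕ) = (n : ℝ) + 1 := by push_cast; ring
  have e2 : ((n + 2 : ℕ) : ℝ) = (n : ℝ) + 2 := by push_cast; ring
  have e3 : ((n + 1 : ℕ) : ℝ) + 1 = (n : ℝ) + 2 := by push_cast; ring
  rw [e1, e2] at h1
  have e4 : phase f t (n + 1) - phase f t n =
      phase f t n * (Complex.exp (Complex.I * ((t * (f (n + 2) - f (n + 1)) : ℝ) : ℂ)) - 1) := by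
    rw [mul_sub, mul_one, phase, phase, ← Complex.exp_add, e3]
    congr 2
    push_cast
    ring
  rw [e4, norm_mul, norm_phase, one_mul]
  refine Real.norm_exp_I_mul_ofReal_sub_one_le.trans ?_
  rw [Real.norm_eq_abs, abs_mul, mul_div_assoc]
  gcongr
  rw [le_div_iff₀ (by positivity), mul_comm, abs_sub_comm]
  exact h1

theorem boundedDiffs_of_mem_S {k : ℕ} {f : ℝ → ℝ} (hf : f ∈ S k) : BoundedDiffs k f := by
  intro j hj hjk
  obtain ⟨L, hL⟩ := hf.2 j hj hjk
  obtain ⟨C, hC⟩ := hL.bddAbove_range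
  exact ⟨C, fun n _ => hC ⟨n, rfl⟩⟩

end Phase

/-! ### The C₀-group and its generator. -/

section Group

variable {p : ℝ≥0∞} {k : ℕ} {f : ℝ → ℝ}

/-- The dominating sequence is independent of `t`; this uniformity serves dominated convergence as
`t → 0`. -/
theorem exists_dominating (hp : 1 < p) (hp' : p ≠ ⊤) (hk : 1 ≤ k) (hf : BoundedDiffs k f)
    {c : ℕ → ℂ} (hc : Memℓp ((diff ^ k) c) p) :
    ∃ g : ℕ → ℝ, Memℓp g p ∧ ∀ t n,
      ‖(diff ^ k) (phase f t * c) n - phase f t n * (diff ^ k) c n‖ ≤ |t| * g n := by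
  obtain ⟨C, hC⟩ := norm_phase_succ_sub_le hk hf
  refine ⟨_, (memℓp_average hp hp' hc).const_mul (4 ^ k * C), fun t n => ?_⟩
  refine (norm_diff_pow_mul_sub_le c (phase f t) (hC t) k le_rfl n).trans_eq ?_
  ring

theorem memℓp_phase_mul (hp : 1 < p) (hp' : p ≠ ⊤) (hk : 1 ≤ k) (hf : BoundedDiffs k f) (t : ℝ)
    {c : ℕ → ℂ} (hc : Memℓp ((diff ^ k) c) p) : Memℓp ((diff ^ k) (phase f t * c)) p := by
  obtain ⟨g, hg, hle⟩ := exists_dominating hp hp' hk hf hc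
  refine Memℓp.mono ((hg.const_mul |t|).add hc.norm) fun n => ?_
  have h1 := norm_sub_norm_le ((diff ^ k) (phase f t * c) n) (phase f t n * (diff ^ k) c n)
  rw [norm_mul, norm_phase, one_mul] at h1
  have h2 := hle t n
  simp only [Pi.add_apply]
  linarith

variable [Fact (1 ≤ p)] {e : SchauderBasis ℂ (lp (fun _ : ℕ => ℂ) p)}
  (hp : 1 < p) (hp' : p ≠ ⊤) (he : IsSymmetricBasis e) (hk : 1 ≤ k)
  (hf : BoundedDiffs k f)

/-- The group of multiplications by `exp (i t f(n))` on the space of formal series. -/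
noncomputable def phaseGroup (t : ℝ) : FormalSpace e k →L[ℂ] FormalSpace e k :=
  mulCLM (phase f t) fun c hc => (he.mem_formalSubmodule_iff hp' _).2
    (memℓp_phase_mul hp hp' hk hf t ((he.mem_formalSubmodule_iff hp' c).1 hc))

theorem coeff_phaseGroup (t : ℝ) (x : FormalSpace e k) (n : ℕ) :
    FormalSpace.coeff (phaseGroup hp hp' he hk hf t x) n =
      phase f t n * FormalSpace.coeff x n := rfl

theorem phaseGroup_zero :
    phaseGroup hp hp' he hk hf 0 = ContinuousLinearMap.id ℂ (FormalSpace e k) :=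
  ContinuousLinearMap.ext fun x => FormalSpace.ext_coeff fun n => by
    rw [coeff_phaseGroup, phase_zero, one_mul]
    rfl

theorem phaseGroup_add (s t : ℝ) : phaseGroup hp hp' he hk hf (s + t) =
    (phaseGroup hp hp' he hk hf s).comp (phaseGroup hp hp' he hk hf t) :=
  ContinuousLinearMap.ext fun x => FormalSpace.ext_coeff fun n => by
    rw [ContinuousLinearMap.comp_apply, coeff_phaseGroup, coeff_phaseGroup, coeff_phaseGroup,
      phase_add, mul_assoc]

theorem tendsto_phaseGroup_zero (x : FormalSpace e k) :
    Tendsto (fun t => phaseGroup hp hp' he hk hf t x) (𝓝 0) (𝓝 x) := by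
  obtain ⟨V, hV⟩ := he.exists_formalEquiv (k := k) hp'
  have hc : Memℓp ((diff ^ k) (FormalSpace.coeff x)) p := (he.mem_formalSubmodule_iff hp' _).1 x.2
  obtain ⟨g, hg, hle⟩ := exists_dominating hp hp' hk hf hc
  have hU : ∀ t, FormalSpace.coeff (phaseGroup hp hp' he hk hf t x) =
      phase f t * FormalSpace.coeff x := fun t => rfl
  have key : Tendsto (fun t => V (phaseGroup hp hp' he hk hf t x - x)) (𝓝 0) (𝓝 0) := by
    have happ : ∀ t n, V (phaseGroup hp hp' he hk hf t x - x) n =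
        (diff ^ k) (phase f t * FormalSpace.coeff x) n - (diff ^ k) (FormalSpace.coeff x) n := by
      intro t n
      rw [hV, map_sub, map_sub, hU, Pi.sub_apply]
    refine tendsto_lp_of_dominated hp' (hg.norm.add (hc.norm.const_mul 2)) (fun n => ?_) ?_
    · simp only [happ]
      have h1 := continuous_diff_pow (c := fun t => phase f t * FormalSpace.coeff x)
        (fun m => (continuous_phase f m).mul continuous_const) k n
      have h2 := (h1.tendsto 0).sub_const ((diff ^ k) (FormalSpace.coeff x) n)
      have h3 : phase f 0 * FormalSpace.coeff x = FormalSpace.coeff x := by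
        funext m
        rw [Pi.mul_apply, phase_zero, one_mul]
      rwa [h3, sub_self] at h2
    · have ht : ∀ᶠ t : ℝ in 𝓝 0, |t| < 1 :=
        (continuous_abs.tendsto (0 : ℝ)).eventually (gt_mem_nhds (by simp))
      refine ht.mono fun t ht n => ?_
      rw [happ]
      -- The commutator is dominated by `g` for `|t| < 1`, and the remaining term by `2 * |Δ^k c|`.
      have e1 : (diff ^ k) (phase f t * FormalSpace.coeff x) n - (diff ^ k) (FormalSpace.coeff x) n =
          ((diff ^ k) (phase f t * FormalSpace.coeff x) n
            - phase f t n * (diff ^ k) (FormalSpace.coeff x) n)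
          + (phase f t n - 1) * (diff ^ k) (FormalSpace.coeff x) n := by ring
      rw [e1]
      refine (norm_add_le _ _).trans ?_
      simp only [Pi.add_apply]
      refine add_le_add ((hle t n).trans ?_) ?_
      · calc |t| * g n ≤ |t| * ‖g n‖ := mul_le_mul_of_nonneg_left (Real.le_norm_self _) (abs_nonneg t)
          _ ≤ 1 * ‖g n‖ := mul_le_mul_of_nonneg_right ht.le (norm_nonneg _)
          _ = ‖g n‖ := one_mul _
      · rw [norm_mul]
        refine mul_le_mul_of_nonneg_right ((norm_sub_le _ _).trans ?_) (norm_nonneg _)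
        rw [norm_phase, norm_one]
        norm_num
  have h4 := (V.symm.continuous.tendsto 0).comp key
  rw [map_zero] at h4
  have h5 := h4.add_const x
  rw [zero_add] at h5
  refine h5.congr fun t => ?_
  simp

theorem isC0Group_phaseGroup : IsC0Group (phaseGroup hp hp' he hk hf) where
  map_zero := phaseGroup_zero hp hp' he hk hf
  map_add := phaseGroup_add hp hp' he hk hf
  continuous x := by
    refine continuous_iff_continuousAt.2 fun t => ?_
    have h1 := tendsto_phaseGroup_zero hp hp' he hk hf (phaseGroup hp hp' he hk hf t x)
    have h2 : Tendsto (fun s : ℝ => s - t) (𝓝 t) (𝓝 0) := by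
      have : Continuous fun s : ℝ => s - t := by fun_prop
      simpa using this.tendsto t
    refine (h1.comp h2).congr fun s => ?_
    rw [Function.comp_apply, ← ContinuousLinearMap.comp_apply, ← phaseGroup_add, sub_add_cancel]

/-- Coefficient functionals are continuous, so they pass through the integral and leave the scalar
fundamental theorem of calculus. -/
theorem phaseGroup_sub_eq_integral {x y : FormalSpace e k}
    (hxy : ∀ n : ℕ, FormalSpace.coeff y n = Complex.I * (f (n + 1) : ℂ) * FormalSpace.coeff x n)
    (t : ℝ) : phaseGroup hp hp' he hk hf t x - x =
      ∫ s in (0 : ℝ)..t, phaseGroup hp hp' he hk hf s y := by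
  refine FormalSpace.ext_coeff fun n => ?_
  have hcont := (isC0Group_phaseGroup hp hp' he hk hf).continuous y
  have h1 := (coeffCLM (e := e) (k := k) n).intervalIntegral_comp_comm
    (hcont.intervalIntegrable (μ := MeasureTheory.volume) 0 t)
  rw [← coeffCLM_apply n (∫ s in (0 : ℝ)..t, phaseGroup hp hp' he hk hf s y), ← h1]
  simp only [coeffCLM_apply, coeff_phaseGroup]
  have hd : ∀ s ∈ Set.uIcc 0 t, HasDerivAt (fun s => phase f s n * FormalSpace.coeff x n)
      (phase f s n * FormalSpace.coeff y n) s := by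
    intro s _
    have := (hasDerivAt_phase f s n).mul_const (FormalSpace.coeff x n)
    rwa [mul_assoc, ← hxy] at this
  rw [intervalIntegral.integral_eq_sub_of_hasDerivAt hd
    (((continuous_phase f n).mul continuous_const).intervalIntegrable 0 t), phase_zero, one_mul,
    map_sub, Pi.sub_apply, coeff_phaseGroup]

theorem tendsto_phaseGroup_slope {x y : FormalSpace e k}
    (hxy : ∀ n : ℕ, FormalSpace.coeff y n = Complex.I * (f (n + 1) : ℂ) * FormalSpace.coeff x n) :
    Tendsto (fun t : ℝ => ((t : ℂ)⁻¹) • (phaseGroup hp hp' he hk hf t x - x)) (𝓝[≠] 0) (𝓝 y) := by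
  have hcont := (isC0Group_phaseGroup hp hp' he hk hf).continuous y
  have hd := intervalIntegral.integral_hasDerivAt_right (hcont.intervalIntegrable 0 0)
    (hcont.stronglyMeasurableAtFilter _ _) hcont.continuousAt
  rw [phaseGroup_zero, hasDerivAt_iff_tendsto_slope_zero] at hd
  refine hd.congr fun t => ?_
  rw [zero_add, intervalIntegral.integral_same, sub_zero,
    ← phaseGroup_sub_eq_integral hp hp' he hk hf hxy, ← Complex.ofReal_inv, Complex.coe_smul]

/-- The domain is maximal: if `y` is in the space, then `f c = -i y` is too, so `x` is automatically
in the domain. -/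
theorem mem_graph_diagOp_iff {x y : FormalSpace e k} : (x, y) ∈ (diagOp e k f).graph ↔
    ∀ n : ℕ, FormalSpace.coeff y n = Complex.I * (f (n + 1) : ℂ) * FormalSpace.coeff x n := by
  rw [LinearPMap.mem_graph_iff]
  constructor
  · rintro ⟨u, rfl, rfl⟩ n
    rw [mul_assoc]
    rfl
  · intro h
    have hmem : (fun n : ℕ => (f (n + 1) : ℂ) * FormalSpace.coeff x n) ∈ formalSubmodule e k := by
      have h1 := (formalSubmodule e k).smul_mem (-Complex.I) y.2
      convert h1 using 1
      funext n
      have h2 : (-Complex.I • y.1) n = -Complex.I * FormalSpace.coeff y n := rfl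
      rw [h2, h, ← mul_assoc, ← mul_assoc, neg_mul, Complex.I_mul_I, neg_neg, one_mul]
    refine ⟨⟨x, hmem⟩, rfl, FormalSpace.ext_coeff fun n => ?_⟩
    rw [h, mul_assoc]
    rfl

end Group

/-- On the graph, the difference quotient is an average of the continuous orbit of `y`. Conversely,
a limit of the quotients is determined by its coefficients, which are scalar derivatives at 0. -/
theorem generatesC0Group_diagOp {p : ℝ≥0∞} [Fact (1 ≤ p)]
    {e : SchauderBasis ℂ (lp (fun _ : ℕ => ℂ) p)} {k : ℕ} {f : ℝ → ℝ} (hp : 1 < p) (hp' : p ≠ ⊤)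
    (he : IsSymmetricBasis e) (hk : 1 ≤ k) (hf : BoundedDiffs k f) : GeneratesC0Group (diagOp e k f) := by
  refine ⟨phaseGroup hp hp' he hk hf, isC0Group_phaseGroup hp hp' he hk hf, fun x y => ?_⟩
  rw [mem_graph_diagOp_iff]
  refine ⟨fun h => tendsto_phaseGroup_slope hp hp' he hk hf h, fun h n => ?_⟩
  have h1 := ((continuous_coeff n).tendsto y).comp h
  have h2 := ((hasDerivAt_phase f 0 n).mul_const (FormalSpace.coeff x n)).tendsto_slope_zero
  simp only [phase_zero, one_mul, zero_add] at h2
  refine tendsto_nhds_unique h1 (h2.congr fun t => ?_)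
  rw [← Complex.coe_smul, Complex.ofReal_inv]
  simp [coeff_phaseGroup]

end DiagonalGroup

theorem theorem4 (p : ℝ≥0∞) [Fact (1 ≤ p)] (hp : 1 < p) (hp' : p ≠ ⊤)
    (e : SchauderBasis ℂ (lp (fun _ : ℕ => ℂ) p)) (he : DiagonalGroup.IsSymmetricBasis e)
    (k : ℕ) (hk : 1 ≤ k) :
    -- the space consists of the formal series whose coefficients lie in `ℓ_p(Δ^k)`
    (∀ c : ℕ → ℂ, c ∈ DiagonalGroup.formalSubmodule e k ↔ Memℓp ((DiagonalGroup.diff ^ k) c) p) ∧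
    -- it is the completion of `ℓ_p` for the norm `‖(I - T)^k x‖`, with `T` the right shift
    (CompleteSpace (DiagonalGroup.FormalSpace e k) ∧
      ∃ T : lp (fun _ : ℕ => ℂ) p →L[ℂ] lp (fun _ : ℕ => ℂ) p,
        (∀ n, T (e n) = e (n + 1)) ∧
        ∃ ι : lp (fun _ : ℕ => ℂ) p →ₗ[ℂ] DiagonalGroup.FormalSpace e k,
          (∀ x n, DiagonalGroup.FormalSpace.coeff (ι x) n = e.coord n x) ∧
          (∀ x, ‖ι x‖ = ‖((1 - T) ^ k) x‖) ∧
          DenseRange ι) ∧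
    -- the sequence `(e_n)` lies in the space but is not a Schauder basis of it
    (∃ v : ℕ → DiagonalGroup.FormalSpace e k,
      (∀ n, DiagonalGroup.FormalSpace.coeff (v n) = Pi.single n 1) ∧
      ¬ ∃ b : SchauderBasis ℂ (DiagonalGroup.FormalSpace e k), ∀ n, b n = v n) ∧
    -- the diagonal operator with eigenvalues `i f(n)` generates a C₀-group, for `f` in `𝒮_k`
    (∀ f ∈ DiagonalGroup.S k, DiagonalGroup.GeneratesC0Group (DiagonalGroup.diagOp e k f)) ∧
    -- and also without `f(x) → ∞`
    (∀ f : ℝ → ℝ, DiagonalGroup.BoundedDiffs k f →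
      DiagonalGroup.GeneratesC0Group (DiagonalGroup.diagOp e k f)) := by
  open DiagonalGroup in
  exact ⟨fun c => he.mem_formalSubmodule_iff hp' c,
    ⟨inferInstance, he.exists_completion hp hp' k⟩,
    he.exists_units_not_basis hp' hk,
    fun _ hf => generatesC0Group_diagOp hp hp' he hk (boundedDiffs_of_mem_S hf),
    fun _ hf => generatesC0Group_diagOp hp hp' he hk hf⟩
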